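/- Let \(d\ge 0\) be an integer and let \(\mu:\mathbb{R}\to[0,\infty)\) be a probability density function (with respect to Lebesgue measure). Assume that \(P_0,\dots,P_d\) are real polynomials with \(\deg P_i=i\) that are orthonormal for \(\mu\), i.e. \(\int_{\mathbb{R}}P_i(t)P_j(t)\,\mu(t)\,dt=1\) if \(i=j\) and \(=0\) if \(i\ne j\), for \(0\le i,j\le d\). The \(\mu\)-unitary ensemble is the distribution on the \((d+1)\times(d+1)\) complex Hermitian matrices with density \(q_\mu(X)\propto\prod_{i=1}^{d+1}\mu(\lambda_i(X))\) with respect to Lebesgue measure \(\prod_i dX_{ii}\prod_{i<j}d\,\mathrm{Re}X_{ij}\,d\,\mathrm{Im}X_{ij}\), where \(\lambda_1(X),\dots,\lambda_{d+1}(X)\) are the eigenvalues of \(X\), repeated according to multiplicity. The projection DPP for \(\mu\) is the distribution over unordered sets \(S=\{t_1,\dots,t_{d+1}\}\) of real points with density \[ q(S)=|\det A_S|^2\prod_{i=1}^{d+1}\mu(t_i),\qquad A_S=[\,a_{t_1}\ \cdots\ a_{t_{d+1}}]\in\mathbb{R}^{(d+1)\times(d+1)},\quad a_t=[P_0(t)\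 \cdots\ P_d(t)]^\top , \] with respect to Lebesgue measure on unordered \((d+1)\)-point configurations, i.e. the image of Lebesgue measure on \(\mathbb{R}^{d+1}\) under forgetting the order, divided by \((d+1)!\). Then the \(\mu\)-unitary ensemble is well defined (the density can be normalized to a probability density). Moreover, if \(X\) is a random matrix drawn from the \(\mu\)-unitary ensemble, then almost surely its \(d+1\) eigenvalues are distinct, and the random unordered set \(\{\lambda_1(X),\dots,\lambda_{d+1}(X)\}\) is distributed exactly as the projection DPP for \(\mu\). -/

import Mathlib

open MeasureTheory ProbabilityTheory Polynomial
open scoped ENNReal Nat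

namespace ProjDPP

noncomputable section

/-- `μ : ℝ → ℝ` is a probability density function (with respect to Lebesgue measure). -/
structure IsPDF (μ : ℝ → ℝ) : Prop where
  measurable : Measurable μ
  nonneg : ∀ t, 0 ≤ μ t
  lintegral_eq_one : ∫⁻ t, ENNReal.ofReal (μ t) = 1

/-- The distribution on `ℝ` with pdf `μ`. -/
def distr (μ : ℝ → ℝ) : Measure ℝ :=
  volume.withDensity fun t => ENNReal.ofReal (μ t)

/-- `p 0, …, p d` are orthonormal polynomials for `μ`: `p i` has degree `i` and
`E_{t ∼ μ}[p i (t) * p j (t)] = 1` if `i = j` and `0` otherwise.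
(The case `i = j` forces each `(p i)²` to be integrable, as otherwise the integral would be `0`;
hence all the products are integrable.) -/
structure IsOrthonormalPolys (μ : ℝ → ℝ) {d : ℕ} (p : Fin (d + 1) → ℝ[X]) : Prop where
  degree_eq : ∀ i, (p i).degree = (i : ℕ)
  orthonormal : ∀ i j,
    ∫ t, (p i).eval t * (p j).eval t ∂(distr μ) = if i = j then 1 else 0

/-! ### Configurations of `n` unlabelled real points -/

/-- Two labelled `n`-tuples are equivalent if they agree up to relabelling. -/
def permSetoid (n : ℕ) : Setoid (Fin n → ℝ) where
  r s t := ∃ σ : Equiv.Perm (Fin n), s = t ∘ σ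
  iseqv :=
    { refl := fun _ => ⟨1, rfl⟩
      symm := by
        rintro s t ⟨σ, rfl⟩
        exact ⟨σ⁻¹, by ext i; simp⟩
      trans := by
        rintro s t u ⟨σ, rfl⟩ ⟨τ, rfl⟩
        exact ⟨τ * σ, by ext i; simp⟩ }

/-- Unordered configurations `{t₁, …, tₙ}` of `n` real points (counted with multiplicity).
It carries the quotient σ-algebra: a set of configurations is measurable iff the set of its
labellings is a Borel set in `ℝⁿ`. -/
abbrev Config (n : ℕ) : Type := Quotient (permSetoid n)

/-- The configuration `{t₁, …, tₙ}` underlying a labelled tuple. -/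
def toConfig {n : ℕ} (t : Fin n → ℝ) : Config n := Quotient.mk (permSetoid n) t

/-- Lebesgue measure on configurations of `n` points: the image of Lebesgue measure on `ℝⁿ`,
divided by the number `n!` of labellings (equivalently, Lebesgue measure on `t₁ < ⋯ < tₙ`).
Densities of random `n`-point sets are taken with respect to it. -/
def configLebesgue (n : ℕ) : Measure (Config n) :=
  ((n ! : ℝ≥0∞))⁻¹ • (volume : Measure (Fin n → ℝ)).map toConfig

/-! ### The projection DPP -/

/-- The matrix `A_S = [a_{t₁} ⋯ a_{t_{d+1}}]` with columns `a_t = (p 0 (t), …, p d (t))ᵀ`. -/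
def designMatrix {d : ℕ} (p : Fin (d + 1) → ℝ[X]) (t : Fin (d + 1) → ℝ) :
    Matrix (Fin (d + 1)) (Fin (d + 1)) ℝ :=
  Matrix.of fun i j => (p i).eval (t j)

/-- `|det A_S|² ∏ μ(tᵢ)`, in terms of a labelling of `S`. -/
def dppDensityFun (μ : ℝ → ℝ) {d : ℕ} (p : Fin (d + 1) → ℝ[X]) (t : Fin (d + 1) → ℝ) : ℝ :=
  |(designMatrix p t).det| ^ 2 * ∏ i, μ (t i)

lemma dppDensityFun_comp_perm (μ : ℝ → ℝ) {d : ℕ} (p : Fin (d + 1) → ℝ[X])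
    (t : Fin (d + 1) → ℝ) (σ : Equiv.Perm (Fin (d + 1))) :
    dppDensityFun μ p (t ∘ σ) = dppDensityFun μ p t := by
  have h1 : designMatrix p (t ∘ σ) = (designMatrix p t).submatrix id σ := by
    ext i j
    simp [designMatrix]
  have h2 : ∏ i, μ ((t ∘ σ) i) = ∏ i, μ (t i) := Equiv.prod_comp σ fun i => μ (t i)
  rw [dppDensityFun, dppDensityFun, h1, h2, Matrix.det_permute', abs_mul]
  rcases Int.units_eq_one_or (Equiv.Perm.sign σ) with h | h <;> simp [h]

/-- The density `q(S) = |det A_S|² ∏ μ(tᵢ)` as a function of the set `S = {t₁, …, t_{d+1}}`. -/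
def dppDensity (μ : ℝ → ℝ) {d : ℕ} (p : Fin (d + 1) → ℝ[X]) : Config (d + 1) → ℝ :=
  Quotient.lift (dppDensityFun μ p) (by
    rintro _ t ⟨σ, rfl⟩
    exact dppDensityFun_comp_perm μ p t σ)

/-- The projection DPP for `μ`: the distribution over sets `S = {t₁, …, t_{d+1}}`
with pdf `q(S) = |det A_S|² ∏ μ(tᵢ)`. No normalizing constant is involved. -/
def projectionDPP (μ : ℝ → ℝ) {d : ℕ} (p : Fin (d + 1) → ℝ[X]) : Measure (Config (d + 1)) :=
  (configLebesgue (d + 1)).withDensity fun S => ENNReal.ofReal (dppDensity μ p S)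

/-! ### Random Hermitian matrices -/

/-- `n × n` complex Hermitian matrices (with the topology of entrywise convergence). -/
abbrev HermMat (n : ℕ) : Type := {A : Matrix (Fin n) (Fin n) ℂ // A.IsHermitian}

instance instMeasurableSpaceHermMat (n : ℕ) : MeasurableSpace (HermMat n) := borel _

instance instBorelSpaceHermMat (n : ℕ) : BorelSpace (HermMat n) := ⟨rfl⟩

/-- The Hermitian matrix with given (real) diagonal and (complex) strictly upper triangular
entries. -/
def hermOfCoords {n : ℕ}
    (x : (Fin n → ℝ) × ({e : Fin n × Fin n // e.1 < e.2} → ℂ)) : HermMat n :=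
  ⟨Matrix.of fun i j =>
      if h : i < j then x.2 ⟨(i, j), h⟩
      else if h : j < i then star (x.2 ⟨(j, i), h⟩)
      else (x.1 i : ℂ), by
    ext i j
    rcases lt_trichotomy i j with h | rfl | h
    · simp [Matrix.conjTranspose_apply, h, h.not_gt]
    · simp [Matrix.conjTranspose_apply]
    · simp [Matrix.conjTranspose_apply, h, h.not_gt]⟩

/-- Lebesgue measure `∏ᵢ dAᵢᵢ ∏_{i<j} dRe(Aᵢⱼ) dIm(Aᵢⱼ)` on the Hermitian matrices. -/
def hermLebesgue (n : ℕ) : Measure (HermMat n) :=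
  Measure.map hermOfCoords volume

/-- The unnormalized density `∏ μ(λᵢ(A))`; the `λᵢ(A)` are the eigenvalues of `A`, repeated
according to multiplicity. -/
def ensembleWeight (μ : ℝ → ℝ) {n : ℕ} (A : HermMat n) : ℝ :=
  ∏ i, μ (A.2.eigenvalues i)

/-- The `μ`-unitary ensemble: the distribution on `n × n` Hermitian matrices with pdf proportional
to `∏ μ(λᵢ(A))`. -/
def unitaryEnsemble (μ : ℝ → ℝ) (n : ℕ) : Measure (HermMat n) :=
  (∫⁻ A, ENNReal.ofReal (ensembleWeight μ A) ∂(hermLebesgue n))⁻¹ •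
    (hermLebesgue n).withDensity fun A => ENNReal.ofReal (ensembleWeight μ A)

/-- The unordered collection of the eigenvalues of a Hermitian matrix. -/
def eigenvalueConfig {n : ℕ} (A : HermMat n) : Config n := toConfig A.2.eigenvalues

end

end ProjDPP

/-!
The eigenvalues of a Hermitian matrix, listed in decreasing order, have under Lebesgue measure a
density proportional to the squared Vandermonde determinant on the chamber of decreasing tuples.
This is the Weyl integration formula, `exists_weylFormula`. Weighting by `∏ μ(λᵢ)` and
using `det A_S = ∏ lc(Pᵢ) * Vandermonde`, the image of the unnormalized ensemble on configurations
is a constant multiple of the projection DPP. Andréief's identity `lintegral_dppDensityFun` shows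
that the DPP has total mass one, so the constant is the normalizing constant of the ensemble.
Its value never matters, only that it is neither zero nor infinite.

The Weyl formula is proved by induction on the dimension, by splitting off the top eigenvalue. For
`z ∈ ℂⁿ` let `R(z)` be the reflection in the hyperplane orthogonal to `(1, -z)`. The map
`conjMap : (a, z, B) ↦ R(z) (a ⊕ B) R(z)` is defined on triples with `|z| < 1` and `a` above the
spectrum of `B`.

* It is injective (`injOn_conjMap`): `a` is the top eigenvalue, it is simple, and the line of its
  eigenvectors determines `z`.
* Its image is conull (`WeylFormula.ae_mem_image`). It contains every matrix `[[a, zᴴ], [z, B]]` for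
  which the vectors `Bᵏ z` span, since no eigenvector of such a matrix has first entry `0`. The
  spanning condition holds for almost all `z` as soon as `B` has distinct eigenvalues, which is
  almost sure by the formula one dimension lower.
* Its Jacobian is `j(z) |det (a - B)|²` (`exists_hasFDerivAt_conjMap_det`). In the frame given by
  `R = R(z)`, the derivative of `R (a ⊕ B) R` is the sum of `d(a ⊕ B)` and the commutator of `R dR`
  with `a ⊕ B`. The commutator acts on the column of the matrix through `a - B`, a complex linear
  map whose real determinant is the squared modulus of its complex one.

The variable `z` therefore separates and contributes a constant, and `∏ (a - λᵢ(B))²` completes the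
squared Vandermonde determinant of the eigenvalues of `B` to that of all eigenvalues.
-/

namespace ProjDPP

noncomputable section

/-! ### Coordinates on the Hermitian matrices -/

/-- The coordinates of an `n × n` Hermitian matrix: its diagonal and its strictly upper triangular
entries. -/
abbrev Coord (n : ℕ) : Type := (Fin n → ℝ) × ({e : Fin n × Fin n // e.1 < e.2} → ℂ)

/-- The Hermitian matrix with given coordinates, as a linear map to all matrices. -/
def toMat {n : ℕ} : Coord n →ₗ[ℝ] Matrix (Fin n) (Fin n) ℂ where
  toFun x := (hermOfCoords x).1
  map_add' x y := by
    ext i j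
    simp only [hermOfCoords, Matrix.of_apply, Matrix.add_apply]
    split_ifs <;> simp
  map_smul' c x := by
    ext i j
    simp only [hermOfCoords, Matrix.of_apply, Matrix.smul_apply]
    split_ifs <;> simp

/-- The coordinates of a matrix, which determine it if it is Hermitian. -/
def fromMat {n : ℕ} : Matrix (Fin n) (Fin n) ℂ →ₗ[ℝ] Coord n where
  toFun A := (fun i => (A i i).re, fun e => A e.1.1 e.1.2)
  map_add' A B := by ext <;> simp
  map_smul' c A := by ext <;> simp

lemma toMat_isHermitian {n : ℕ} (x : Coord n) : (toMat x).IsHermitian := (hermOfCoords x).2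

lemma fromMat_toMat {n : ℕ} (x : Coord n) : fromMat (toMat x) = x := by
  ext i
  · simp [fromMat, toMat, hermOfCoords]
  · obtain ⟨⟨a, b⟩, h⟩ := i
    simp only [fromMat, toMat, hermOfCoords, LinearMap.coe_mk, AddHom.coe_mk, Matrix.of_apply]
    rw [dif_pos h]

lemma toMat_fromMat {n : ℕ} {A : Matrix (Fin n) (Fin n) ℂ} (hA : A.IsHermitian) :
    toMat (fromMat A) = A := by
  ext i j
  simp only [fromMat, toMat, hermOfCoords, LinearMap.coe_mk, AddHom.coe_mk, Matrix.of_apply]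
  split_ifs with h1 h2
  · rfl
  · exact hA.apply i j
  · obtain rfl : i = j := le_antisymm (not_lt.1 h2) (not_lt.1 h1)
    exact Complex.conj_eq_iff_re.1 (hA.apply i i)

lemma continuous_hermOfCoords {n : ℕ} : Continuous (hermOfCoords (n := n)) := by
  refine Continuous.subtype_mk (continuous_matrix fun i j => ?_) _
  simp only [Matrix.of_apply]
  split_ifs <;> fun_prop

/-! ### Sorted eigenvalues -/

/-- The eigenvalues of a Hermitian matrix in decreasing order. -/
def sortedEigenvalues {n : ℕ} (A : HermMat n) : Fin n → ℝ :=
  A.2.eigenvalues₀ ∘ Fin.cast (Fintype.card_fin n).symm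

lemma sortedEigenvalues_antitone {n : ℕ} (A : HermMat n) : Antitone (sortedEigenvalues A) :=
  fun _ _ h => A.2.eigenvalues₀_antitone h

/-- Mathlib indexes the eigenvalues of a matrix by its index type through an arbitrary bijection, so
they are a permutation of the sorted ones. -/
lemma exists_perm_eigenvalues {n : ℕ} (A : HermMat n) :
    ∃ σ : Equiv.Perm (Fin n), A.2.eigenvalues = sortedEigenvalues A ∘ σ :=
  ⟨(Fintype.equivOfCardEq (Fintype.card_fin _)).symm.trans (finCongr (Fintype.card_fin n)), rfl⟩

lemma charpoly_eq_prod_sortedEigenvalues {n : ℕ} (A : HermMat n) :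
    A.1.charpoly = ∏ i, (X - C (sortedEigenvalues A i : ℂ)) := by
  obtain ⟨σ, hσ⟩ := exists_perm_eigenvalues A
  rw [A.2.charpoly_eq, hσ]
  exact Equiv.prod_comp σ fun i => (X - C (sortedEigenvalues A i : ℂ))

lemma antitone_eq_of_prod_eq {n : ℕ} {s t : Fin n → ℝ} (hs : Antitone s) (ht : Antitone t)
    (h : ∏ i, (X - C (s i)) = ∏ i, (X - C (t i))) : s = t := by
  have hr (t : Fin n → ℝ) : (∏ i, (X - C (t i))).roots = Multiset.map t Finset.univ.val := by
    rw [roots_prod _ _ (by simp [Finset.prod_ne_zero_iff, X_sub_C_ne_zero])]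
    simp
  have h1 := congrArg roots h
  rw [hr, hr, Fin.univ_val_map, Fin.univ_val_map,
    Multiset.coe_eq_coe] at h1
  exact List.ofFn_inj.1 (h1.eq_of_pairwise (le := (· ≥ ·)) (fun a b _ _ h1 h2 => le_antisymm h2 h1)
    (List.sortedGE_iff_pairwise.1 hs.sortedGE_ofFn) (List.sortedGE_iff_pairwise.1 ht.sortedGE_ofFn))

lemma sortedEigenvalues_eq {n : ℕ} {A : HermMat n} {t : Fin n → ℝ} (ht : Antitone t)
    (h : A.1.charpoly = ∏ i, (X - C (t i : ℂ))) : sortedEigenvalues A = t := by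
  refine antitone_eq_of_prod_eq (sortedEigenvalues_antitone A) ht ?_
  rw [charpoly_eq_prod_sortedEigenvalues] at h
  apply Polynomial.map_injective (algebraMap ℝ ℂ) Complex.ofReal_injective
  simpa [Polynomial.map_prod] using h

lemma charpoly_eval_sub {n : ℕ} (A : HermMat n) (c : ℂ) :
    (Matrix.scalar (Fin n) c - A.1).det = ∏ i, (c - (sortedEigenvalues A i : ℂ)) := by
  rw [← Matrix.eval_charpoly, charpoly_eq_prod_sortedEigenvalues, eval_prod]
  simp

/-- The values at the naturals of the polynomial with roots `t` depend continuously on `t` and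
determine the decreasing tuple `t`. Since they are also continuous functions of the matrix with
eigenvalues `t`, the Lusin–Souslin theorem makes `t` a measurable function of the matrix. -/
lemma measurable_sortedEigenvalues {n : ℕ} : Measurable (sortedEigenvalues (n := n)) := by
  have hcl : IsClosed {t : Fin n → ℝ | Antitone t} := by
    simp only [Antitone, Set.ofPred_forall]
    exact isClosed_iInter fun i => isClosed_iInter fun j => isClosed_iInter fun _ =>
      isClosed_le (continuous_apply j) (continuous_apply i)
  have : PolishSpace {t : Fin n → ℝ // Antitone t} := hcl.polishSpace
  let e : {t : Fin n → ℝ // Antitone t} → ℕ → ℝ := fun t k => ∏ i, ((k : ℝ) - t.1 i)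
  have he : Continuous e :=
    continuous_pi fun k => continuous_finsetProd _ fun i _ =>
      continuous_const.sub ((continuous_apply i).comp continuous_subtype_val)
  have hinj : Function.Injective e := by
    intro s t hst
    refine Subtype.ext (antitone_eq_of_prod_eq s.2 t.2 ?_)
    refine Polynomial.eq_of_infinite_eval_eq _ _ ?_
    refine (Set.infinite_range_of_injective (Nat.cast_injective (R := ℝ))).mono ?_
    rintro _ ⟨k, rfl⟩
    have := congrFun hst k
    simpa [e, eval_prod] using this
  have hemb := he.measurableEmbedding hinj
  have hm : Measurable fun A : HermMat n =>
      (⟨sortedEigenvalues A, sortedEigenvalues_antitone A⟩ : {t : Fin n → ℝ // Antitone t}) := by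
    rw [← hemb.measurable_comp_iff]
    have hc : Continuous fun (A : HermMat n) (k : ℕ) =>
        ((Matrix.scalar (Fin n) (k : ℂ) - A.1).det).re := by fun_prop
    convert hc.measurable using 1
    ext A k
    simp only [charpoly_eval_sub, e, Function.comp]
    norm_cast
  exact measurable_subtype_coe.comp hm

/-! ### Splitting off one row and column -/

/-- Coordinates of an `(n + 1) × (n + 1)` Hermitian matrix `[[a, zᴴ], [z, B]]`: the corner `a`, the
column `z`, and the coordinates of the remaining block `B`. -/
abbrev BlockCoord (n : ℕ) : Type := ℝ × (Fin n → ℂ) × Coord n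

/-- Square matrices with a distinguished first row and column. -/
abbrev BlockMat (n : ℕ) : Type := Matrix (Unit ⊕ Fin n) (Unit ⊕ Fin n) ℂ

/-- The Hermitian matrix `[[a, zᴴ], [z, B]]`. -/
def toBlock {n : ℕ} : BlockCoord n →ₗ[ℝ] BlockMat n where
  toFun y := Matrix.fromBlocks (Matrix.of fun _ _ => (y.1 : ℂ))
    (Matrix.of fun _ j => star (y.2.1 j)) (Matrix.of fun i _ => y.2.1 i) (toMat y.2.2)
  map_add' x y := by
    ext (i | i) (j | j) <;> simp
  map_smul' c x := by
    ext (i | i) (j | j) <;> simp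

/-- The block coordinates of a matrix, which determine it if it is Hermitian. -/
def fromBlock {n : ℕ} : BlockMat n →ₗ[ℝ] BlockCoord n where
  toFun A := ((A (.inl ()) (.inl ())).re, fun i => A (.inr i) (.inl ()), fromMat A.toBlocks₂₂)
  map_add' A B := by
    refine Prod.ext (by simp) (Prod.ext (by ext; simp) ?_)
    exact map_add fromMat A.toBlocks₂₂ B.toBlocks₂₂
  map_smul' c A := by
    refine Prod.ext (by simp) (Prod.ext (by ext; simp) ?_)
    exact map_smul fromMat c A.toBlocks₂₂

@[simp] lemma toBlock_inl_inl {n : ℕ} (y : BlockCoord n) (i j : Unit) :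
    toBlock y (.inl i) (.inl j) = y.1 := rfl
@[simp] lemma toBlock_inl_inr {n : ℕ} (y : BlockCoord n) (i : Unit) (j : Fin n) :
    toBlock y (.inl i) (.inr j) = star (y.2.1 j) := rfl
@[simp] lemma toBlock_inr_inl {n : ℕ} (y : BlockCoord n) (i : Fin n) (j : Unit) :
    toBlock y (.inr i) (.inl j) = y.2.1 i := rfl
@[simp] lemma toBlock_inr_inr {n : ℕ} (y : BlockCoord n) (i j : Fin n) :
    toBlock y (.inr i) (.inr j) = toMat y.2.2 i j := rfl

lemma toBlock_isHermitian {n : ℕ} (y : BlockCoord n) : (toBlock y).IsHermitian := by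
  ext (i | i) (j | j)
  · simp [Matrix.conjTranspose_apply]
  · simp [Matrix.conjTranspose_apply]
  · simp [Matrix.conjTranspose_apply]
  · exact (toMat_isHermitian y.2.2).apply i j

lemma fromBlock_toBlock {n : ℕ} (y : BlockCoord n) : fromBlock (toBlock y) = y :=
  Prod.ext (by simp [fromBlock]) (Prod.ext (by simp [fromBlock]) (fromMat_toMat y.2.2))

lemma toBlock_fromBlock {n : ℕ} {A : BlockMat n} (hA : A.IsHermitian) :
    toBlock (fromBlock A) = A := by
  ext (i | i) (j | j)
  · exact Complex.conj_eq_iff_re.1 (hA.apply (.inl ()) (.inl ()))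
  · exact hA.apply (.inl ()) (.inr j)
  · rfl
  · have h : A.toBlocks₂₂.IsHermitian := by
      ext i j
      exact hA.apply (.inr i) (.inr j)
    exact congrFun (congrFun (toMat_fromMat h) i) j

lemma toBlock_injective {n : ℕ} : Function.Injective (toBlock (n := n)) :=
  Function.LeftInverse.injective fromBlock_toBlock

/-! ### A smooth family of reflections -/

/-- The squared norm of `z`. -/
def normSum {n : ℕ} (z : Fin n → ℂ) : ℝ := ∑ i, Complex.normSq (z i)

lemma normSum_nonneg {n : ℕ} (z : Fin n → ℂ) : 0 ≤ normSum z :=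
  Finset.sum_nonneg fun _ _ => Complex.normSq_nonneg _

lemma one_add_normSum_ne_zero {n : ℕ} (z : Fin n → ℂ) : 1 + (normSum z : ℂ) ≠ 0 := by
  have := normSum_nonneg z
  exact_mod_cast (by positivity : (0 : ℝ) < 1 + normSum z).ne'

/-- The vector `(1, -z)`. -/
def reflVec {n : ℕ} (z : Fin n → ℂ) : Unit ⊕ Fin n → ℂ := Sum.elim (fun _ => 1) (fun i => -z i)

/-- The reflection of `ℂ ^ (n + 1)` in the hyperplane orthogonal to `(1, -z)`. It takes the first
basis vector to a multiple of `(1 - |z|², -2z)`, so that for `|z| < 1` it runs once through the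
lines not orthogonal to the first basis vector. -/
def reflMat {n : ℕ} (z : Fin n → ℂ) : BlockMat n :=
  1 - (2 / (1 + (normSum z : ℂ))) • Matrix.vecMulVec (reflVec z) (star (reflVec z))

lemma reflVec_dotProduct {n : ℕ} (z : Fin n → ℂ) :
    star (reflVec z) ⬝ᵥ reflVec z = 1 + (normSum z : ℂ) := by
  simp [dotProduct, reflVec, normSum, Complex.normSq_eq_conj_mul_self]

lemma reflMat_mul_self {n : ℕ} (z : Fin n → ℂ) : reflMat z * reflMat z = 1 := by
  have h := one_add_normSum_ne_zero z
  have hP : Matrix.vecMulVec (reflVec z) (star (reflVec z)) *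
      Matrix.vecMulVec (reflVec z) (star (reflVec z)) =
      (1 + (normSum z : ℂ)) • Matrix.vecMulVec (reflVec z) (star (reflVec z)) := by
    rw [Matrix.vecMulVec_mul_vecMulVec, reflVec_dotProduct, Matrix.vecMulVec_smul]
  simp only [reflMat, sub_mul, mul_sub, one_mul, mul_one, smul_mul_assoc, mul_smul_comm, hP,
    smul_smul]
  rw [div_mul_cancel₀ _ h]
  module

lemma reflMat_isHermitian {n : ℕ} (z : Fin n → ℂ) : (reflMat z).IsHermitian := by
  rw [Matrix.IsHermitian, reflMat, Matrix.conjTranspose_sub, Matrix.conjTranspose_one,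
    Matrix.conjTranspose_smul, Matrix.conjTranspose_vecMulVec, star_star]
  simp

section Derivative

attribute [local instance] Matrix.linftyOpNormedRing Matrix.linftyOpNormedAlgebra

lemma contDiff_matrix {E ι : Type*} [NormedAddCommGroup E] [NormedSpace ℝ E] [Fintype ι]
    [DecidableEq ι] {k : WithTop ℕ∞} {f : E → Matrix ι ι ℂ}
    (h : ∀ i j, ContDiff ℝ k fun x => f x i j) : ContDiff ℝ k f := by
  have hf : f = fun x => ∑ i, ∑ j, f x i j • Matrix.single i j (1 : ℂ) := by
    ext1 x
    conv_lhs => rw [Matrix.matrix_eq_sum_single (f x)]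
    simp
  rw [hf]
  exact ContDiff.sum fun i _ => ContDiff.sum fun j _ => (h i j).smul contDiff_const

lemma contDiff_normSum {n : ℕ} : ContDiff ℝ 1 (normSum (n := n)) := by
  unfold normSum
  simp only [Complex.normSq_apply]
  have hre : ContDiff ℝ 1 Complex.re := Complex.reCLM.contDiff
  have him : ContDiff ℝ 1 Complex.im := Complex.imCLM.contDiff
  have hz (i : Fin n) : ContDiff ℝ 1 fun z : Fin n → ℂ => z i := contDiff_apply _ _ i
  exact ContDiff.sum fun i _ => ((hre.comp (hz i)).mul (hre.comp (hz i))).add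
    ((him.comp (hz i)).mul (him.comp (hz i)))

lemma contDiff_reflMat {n : ℕ} : ContDiff ℝ 1 (reflMat (n := n)) := by
  have hw (i : Unit ⊕ Fin n) : ContDiff ℝ 1 fun z : Fin n → ℂ => reflVec z i := by
    rcases i with i | i
    · exact contDiff_const
    · exact (contDiff_apply ℝ ℂ i).neg
  have hs : ContDiff ℝ 1 fun z : Fin n → ℂ => (2 / (1 + (normSum z : ℂ))) := by
    have h : ContDiff ℝ 1 fun z : Fin n → ℂ => (2 / (1 + normSum z)) :=
      contDiff_const.div (contDiff_const.add contDiff_normSum)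
        fun z => (add_pos_of_pos_of_nonneg one_pos (normSum_nonneg z)).ne'
    convert! Complex.ofRealCLM.contDiff.comp h using 2 with z
    simp
  refine contDiff_matrix fun i j => ?_
  simp only [reflMat, Matrix.sub_apply, Matrix.smul_apply, Matrix.vecMulVec_apply]
  exact contDiff_const.sub (hs.smul ((hw i).mul (Complex.conjCLE.contDiff.comp (hw j))))

/-- The derivative of the family of reflections. -/
def reflDeriv {n : ℕ} (z : Fin n → ℂ) : (Fin n → ℂ) →ₗ[ℝ] BlockMat n :=
  (fderiv ℝ reflMat z : (Fin n → ℂ) →L[ℝ] BlockMat n)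

lemma hasFDerivAt_reflMat {n : ℕ} (z : Fin n → ℂ) :
    HasFDerivAt reflMat (fderiv ℝ reflMat z) z :=
  (contDiff_reflMat.differentiable one_ne_zero z).hasFDerivAt

lemma reflDeriv_anticomm {n : ℕ} (z v : Fin n → ℂ) :
    reflMat z * reflDeriv z v + reflDeriv z v * reflMat z = 0 := by
  have h := (hasFDerivAt_reflMat z).mul' (hasFDerivAt_reflMat z)
  have h1 : (reflMat * reflMat : (Fin n → ℂ) → BlockMat n) = fun _ => 1 :=
    funext fun z => reflMat_mul_self z
  rw [h1] at h
  have h2 := h.unique (hasFDerivAt_const _ _)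
  simpa using! congrArg (fun f : (Fin n → ℂ) →L[ℝ] BlockMat n => f v) h2

lemma reflDeriv_isHermitian {n : ℕ} (z v : Fin n → ℂ) : (reflDeriv z v).IsHermitian := by
  -- the derivative of a function fixed by the conjugate transpose is fixed by it as well
  let T : BlockMat n →L[ℝ] BlockMat n :=
    LinearMap.toContinuousLinearMap (Matrix.conjTransposeLinearEquiv _ _ ℝ ℂ).toLinearMap
  have h := T.hasFDerivAt.comp z (hasFDerivAt_reflMat z)
  have h1 : T ∘ reflMat = (reflMat : (Fin n → ℂ) → BlockMat n) :=
    funext fun z => reflMat_isHermitian z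
  rw [h1] at h
  exact congrArg (fun f : (Fin n → ℂ) →L[ℝ] BlockMat n => f v) (h.unique (hasFDerivAt_reflMat z))

/-- The lower part of the first column of `R dR`: the velocity, in the frame of the reflection `R`,
of the line spanned by the first column of `R`. -/
def lineDeriv {n : ℕ} (z : Fin n → ℂ) : (Fin n → ℂ) →ₗ[ℝ] (Fin n → ℂ) where
  toFun v i := (reflMat z * reflDeriv z v) (.inr i) (.inl ())
  map_add' u v := by ext; simp [mul_add]
  map_smul' c v := by ext; simp

lemma continuous_det_lineDeriv {n : ℕ} :
    Continuous fun z : Fin n → ℂ => LinearMap.det (lineDeriv z) := by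
  have hc (v : Fin n → ℂ) : Continuous fun z => lineDeriv z v := by
    have h : Continuous fun z => reflMat z * fderiv ℝ reflMat z v :=
      contDiff_reflMat.continuous.mul
        ((contDiff_reflMat.continuous_fderiv one_ne_zero).clm_apply continuous_const)
    refine continuous_pi fun i => ?_
    let T : BlockMat n →ₗ[ℝ] ℂ :=
      { toFun := fun A => A (.inr i) (.inl ()), map_add' := fun _ _ => rfl,
        map_smul' := fun _ _ => rfl }
    exact (LinearMap.toContinuousLinearMap T).continuous.comp h
  let b := Module.finBasis ℝ (Fin n → ℂ)
  simp only [← LinearMap.det_toMatrix b]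
  refine Continuous.matrix_det (continuous_matrix fun i j => ?_)
  simp only [LinearMap.toMatrix_apply]
  exact (LinearMap.toContinuousLinearMap (b.coord i)).continuous.comp (hc (b j))

/-! ### The derivative of the diagonalizing coordinates -/

/-- The block diagonal matrix `a ⊕ B`. -/
def diagBlock {n : ℕ} : BlockCoord n →ₗ[ℝ] BlockMat n :=
  toBlock ∘ₗ LinearMap.prodMap LinearMap.id (LinearMap.prodMap 0 LinearMap.id)

/-- The block coordinates of the matrix which the reflection belonging to `z` takes to `a ⊕ B`. -/
def conjMap {n : ℕ} (y : BlockCoord n) : BlockCoord n :=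
  fromBlock (reflMat y.2.1 * diagBlock y * reflMat y.2.1)

lemma exists_hasFDerivAt_conjMap {n : ℕ} (y : BlockCoord n) :
    ∃ f : BlockCoord n →L[ℝ] BlockCoord n, HasFDerivAt conjMap f y ∧
      ∀ v, f v = fromBlock (reflDeriv y.2.1 v.2.1 * diagBlock y * reflMat y.2.1 +
        reflMat y.2.1 * diagBlock v * reflMat y.2.1 +
        reflMat y.2.1 * diagBlock y * reflDeriv y.2.1 v.2.1) := by
  let pr : BlockCoord n →L[ℝ] (Fin n → ℂ) :=
    (ContinuousLinearMap.fst ℝ _ _).comp (ContinuousLinearMap.snd ℝ _ _)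
  have hR : HasFDerivAt (reflMat ∘ pr) ((fderiv ℝ reflMat (pr y)).comp pr) y :=
    (hasFDerivAt_reflMat (pr y)).comp y pr.hasFDerivAt
  have hD : HasFDerivAt (fun y : BlockCoord n => diagBlock y)
      (LinearMap.toContinuousLinearMap diagBlock) y :=
    (LinearMap.toContinuousLinearMap (diagBlock (n := n))).hasFDerivAt
  have h := (LinearMap.toContinuousLinearMap (fromBlock (n := n))).hasFDerivAt.comp y
    ((hR.mul' hD).mul' hR)
  refine ⟨_, h, fun v => ?_⟩
  change fromBlock ((reflMat y.2.1 * diagBlock y) * reflDeriv y.2.1 v.2.1 +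
    (reflMat y.2.1 * diagBlock v + reflDeriv y.2.1 v.2.1 * diagBlock y) * reflMat y.2.1) = _
  congr 1
  noncomm_ring

end Derivative

/-- The derivative of `R (a ⊕ B) R`, conjugated by the reflection `R = R(z)`. Since `R` and `dR`
anticommute (`reflDeriv_anticomm`), the motion of `R` contributes the commutator of `R dR` with
`a ⊕ B`. -/
def frameDeriv {n : ℕ} (y v : BlockCoord n) : BlockMat n :=
  reflMat y.2.1 * reflDeriv y.2.1 v.2.1 * diagBlock y -
    diagBlock y * (reflMat y.2.1 * reflDeriv y.2.1 v.2.1) + diagBlock v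

/-- Conjugation of a Hermitian matrix by a reflection. -/
def conjRefl {n : ℕ} (z : Fin n → ℂ) : BlockCoord n →ₗ[ℝ] BlockCoord n where
  toFun v := fromBlock (reflMat z * toBlock v * reflMat z)
  map_add' u v := by simp [mul_add, add_mul]
  map_smul' c v := by simp

lemma reflMat_conj_frameDeriv {n : ℕ} (y v : BlockCoord n) :
    reflMat y.2.1 * frameDeriv y v * reflMat y.2.1 =
      reflDeriv y.2.1 v.2.1 * diagBlock y * reflMat y.2.1 +
        reflMat y.2.1 * diagBlock v * reflMat y.2.1 +
        reflMat y.2.1 * diagBlock y * reflDeriv y.2.1 v.2.1 := by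
  have h1 := reflMat_mul_self y.2.1
  have h2 := eq_neg_of_add_eq_zero_left (reflDeriv_anticomm y.2.1 v.2.1)
  have h3 : reflMat y.2.1 * reflDeriv y.2.1 v.2.1 * reflMat y.2.1 = - reflDeriv y.2.1 v.2.1 := by
    rw [h2, neg_mul, mul_assoc, h1, mul_one]
  calc _ = (reflMat y.2.1 * reflMat y.2.1) * reflDeriv y.2.1 v.2.1 * diagBlock y * reflMat y.2.1 +
        reflMat y.2.1 * diagBlock v * reflMat y.2.1 - reflMat y.2.1 * diagBlock y *
          (reflMat y.2.1 * reflDeriv y.2.1 v.2.1 * reflMat y.2.1) := by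
        rw [frameDeriv]; noncomm_ring
    _ = _ := by rw [h1, h3]; noncomm_ring

lemma frameDeriv_isHermitian {n : ℕ} (y v : BlockCoord n) : (frameDeriv y v).IsHermitian := by
  have hd (y : BlockCoord n) : (diagBlock y).conjTranspose = diagBlock y := toBlock_isHermitian _
  have hW : (reflMat y.2.1 * reflDeriv y.2.1 v.2.1).conjTranspose =
      -(reflMat y.2.1 * reflDeriv y.2.1 v.2.1) := by
    rw [Matrix.conjTranspose_mul, (reflDeriv_isHermitian _ _).eq, (reflMat_isHermitian _).eq]
    exact eq_neg_of_add_eq_zero_right (reflDeriv_anticomm y.2.1 v.2.1)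
  rw [Matrix.IsHermitian, frameDeriv, Matrix.conjTranspose_add, Matrix.conjTranspose_sub,
    Matrix.conjTranspose_mul _ (diagBlock y), Matrix.conjTranspose_mul (diagBlock y), hW, hd, hd]
  noncomm_ring

/-- Adding to the block `B` a linear function of the column `z`. -/
def shear {n : ℕ} (g : (Fin n → ℂ) →ₗ[ℝ] Coord n) : BlockCoord n →ₗ[ℝ] BlockCoord n :=
  LinearMap.id + (LinearMap.inr ℝ _ _ ∘ₗ LinearMap.inr ℝ _ _ ∘ₗ g ∘ₗ LinearMap.fst ℝ _ _ ∘ₗ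
    LinearMap.snd ℝ _ _)

/-- The linear map `z ↦ (a - B) z`. -/
def shiftMap {n : ℕ} (y : BlockCoord n) : (Fin n → ℂ) →ₗ[ℂ] (Fin n → ℂ) :=
  Matrix.toLin' (Matrix.scalar (Fin n) (y.1 : ℂ) - toMat y.2.2)

/-- The coordinates of the commutator of the lower right block of `R dR` with `B`. -/
def blockComm {n : ℕ} (y : BlockCoord n) : (Fin n → ℂ) →ₗ[ℝ] Coord n where
  toFun v := fromMat ((reflMat y.2.1 * reflDeriv y.2.1 v).toBlocks₂₂ * toMat y.2.2 -
    toMat y.2.2 * (reflMat y.2.1 * reflDeriv y.2.1 v).toBlocks₂₂)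
  map_add' u v := by
    rw [← map_add]
    congr 1
    rw [map_add, mul_add, show ∀ A B : BlockMat n, (A + B).toBlocks₂₂ = A.toBlocks₂₂ + B.toBlocks₂₂
      from fun _ _ => rfl]
    noncomm_ring
  map_smul' c v := by
    rw [map_smul, mul_smul_comm, show ∀ A : BlockMat n, (c • A).toBlocks₂₂ = c • A.toBlocks₂₂
      from fun _ => rfl, smul_mul_assoc, mul_smul_comm, ← smul_sub, map_smul]
    rfl

/-- In the frame of the reflection, the derivative of `conjMap` is a shear followed by a block
diagonal map. The commutator of `R dR` with `a ⊕ B` has corner entry `0`, and its first column is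
`(a - B)` applied to that of `R dR`. -/
lemma fromBlock_frameDeriv {n : ℕ} (y v : BlockCoord n) :
    fromBlock (frameDeriv y v) =
      LinearMap.prodMap LinearMap.id (LinearMap.prodMap
        ((shiftMap y).restrictScalars ℝ ∘ₗ lineDeriv y.2.1) LinearMap.id)
        (shear (blockComm y) v) := by
  refine Prod.ext ?_ (Prod.ext ?_ ?_)
  · simp [fromBlock, frameDeriv, shear, diagBlock, Matrix.mul_apply, mul_comm]
  · ext i
    simp [fromBlock, frameDeriv, shear, shiftMap, lineDeriv, diagBlock, Matrix.mul_apply]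
    simp only [Matrix.mulVec, dotProduct]
    ring
  · have h (W : BlockMat n) : (W * diagBlock y - diagBlock y * W + diagBlock v).toBlocks₂₂ =
        toMat v.2.2 + (W.toBlocks₂₂ * toMat y.2.2 - toMat y.2.2 * W.toBlocks₂₂) := by
      ext i j
      simp [Matrix.toBlocks₂₂, Matrix.mul_apply, diagBlock]
      ring
    simp only [fromBlock, frameDeriv, LinearMap.coe_mk, AddHom.coe_mk, h]
    rw [map_add, fromMat_toMat]
    rfl

lemma det_shear {n : ℕ} (g : (Fin n → ℂ) →ₗ[ℝ] Coord n) : |LinearMap.det (shear g)| = 1 := by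
  -- the sign change `s` of the block `B` conjugates the shear to its inverse
  let s : BlockCoord n →ₗ[ℝ] BlockCoord n :=
    LinearMap.prodMap LinearMap.id (LinearMap.prodMap LinearMap.id (-LinearMap.id))
  have h1 : s ∘ₗ s = LinearMap.id := by
    refine LinearMap.ext fun v => ?_
    simp [s]
  have h2 : shear g ∘ₗ s ∘ₗ shear g ∘ₗ s = LinearMap.id := by
    refine LinearMap.ext fun v => ?_
    simp [s, shear]
  have h3 := congrArg LinearMap.det h1
  have h4 := congrArg LinearMap.det h2
  simp only [LinearMap.det_comp, LinearMap.det_id] at h3 h4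
  refine (abs_eq zero_le_one).2 (mul_self_eq_one_iff.1 ?_)
  linear_combination h4 - LinearMap.det (shear g) ^ 2 * h3

/-- Conjugation by a reflection is an involution. -/
lemma det_conjRefl {n : ℕ} (z : Fin n → ℂ) : |LinearMap.det (conjRefl z)| = 1 := by
  have h : conjRefl z ∘ₗ conjRefl z = LinearMap.id := by
    refine LinearMap.ext fun v => ?_
    have hH : (reflMat z * toBlock v * reflMat z).IsHermitian := by
      rw [Matrix.IsHermitian, Matrix.conjTranspose_mul, Matrix.conjTranspose_mul,
        (reflMat_isHermitian z).eq, (toBlock_isHermitian v).eq, mul_assoc]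
    have hz := reflMat_mul_self z
    change fromBlock (reflMat z * toBlock (fromBlock (reflMat z * toBlock v * reflMat z)) *
      reflMat z) = v
    rw [toBlock_fromBlock hH, mul_assoc, mul_assoc, hz, mul_one, ← mul_assoc, hz, one_mul,
      fromBlock_toBlock]
  have h1 := congrArg LinearMap.det h
  rw [LinearMap.det_comp, LinearMap.det_id] at h1
  exact (abs_eq zero_le_one).2 (mul_self_eq_one_iff.1 h1)

/-- The Jacobian of `conjMap` is a function of `z` times the squared modulus of `det (a - B)`. -/
lemma exists_hasFDerivAt_conjMap_det {n : ℕ} (y : BlockCoord n) :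
    ∃ f : BlockCoord n →L[ℝ] BlockCoord n, HasFDerivAt conjMap f y ∧
      |f.det| = |LinearMap.det (lineDeriv y.2.1)| *
        ∏ i, (y.1 - sortedEigenvalues (hermOfCoords y.2.2) i) ^ 2 := by
  obtain ⟨f, hf, hv⟩ := exists_hasFDerivAt_conjMap y
  refine ⟨f, hf, ?_⟩
  have h : (f : BlockCoord n →ₗ[ℝ] BlockCoord n) = conjRefl y.2.1 ∘ₗ
      (LinearMap.prodMap LinearMap.id (LinearMap.prodMap
        ((shiftMap y).restrictScalars ℝ ∘ₗ lineDeriv y.2.1) LinearMap.id)) ∘ₗ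
        shear (blockComm y) := by
    refine LinearMap.ext fun v => ?_
    rw [LinearMap.comp_apply, LinearMap.comp_apply, ← fromBlock_frameDeriv]
    simp [conjRefl, toBlock_fromBlock (frameDeriv_isHermitian y v), reflMat_conj_frameDeriv, hv]
  have hdet : LinearMap.det (shiftMap y) =
      ((∏ i, (y.1 - sortedEigenvalues (hermOfCoords y.2.2) i) : ℝ) : ℂ) := by
    rw [shiftMap, LinearMap.det_toLin']
    push_cast
    exact charpoly_eval_sub (hermOfCoords y.2.2) y.1
  rw [ContinuousLinearMap.det, h, LinearMap.det_comp, LinearMap.det_comp, LinearMap.det_prodMap,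
    LinearMap.det_prodMap, LinearMap.det_comp, LinearMap.det_restrictScalars, hdet, abs_mul,
    det_conjRefl, abs_mul, det_shear, LinearMap.det_id, LinearMap.det_id]
  rw [Algebra.norm_complex_apply, Complex.normSq_ofReal]
  simp only [one_mul, mul_one, abs_mul, abs_mul_abs_self, Finset.prod_pow]
  ring

/-! ### Diagonalizing the top eigenvalue -/

lemma injective_sortedEigenvalues_iff {n : ℕ} (A : HermMat n) :
    Function.Injective A.2.eigenvalues ↔ Function.Injective (sortedEigenvalues A) := by
  obtain ⟨σ, hσ⟩ := exists_perm_eigenvalues A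
  rw [hσ]
  exact σ.injective_comp _

/-- The parameters for which `a` exceeds all eigenvalues of `B`, and `z` lies in the unit ball. -/
def topDomain (n : ℕ) : Set (BlockCoord n) :=
  {y | normSum y.2.1 < 1 ∧ ∀ i, sortedEigenvalues (hermOfCoords y.2.2) i < y.1}

lemma diagBlock_apply {n : ℕ} (y : BlockCoord n) : diagBlock y = toBlock (y.1, 0, y.2.2) := rfl

lemma diagBlock_isHermitian {n : ℕ} (y : BlockCoord n) : (diagBlock y).IsHermitian :=
  toBlock_isHermitian _

lemma reflMat_conj_isHermitian {n : ℕ} (z : Fin n → ℂ) {A : BlockMat n} (hA : A.IsHermitian) :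
    (reflMat z * A * reflMat z).IsHermitian := by
  rw [Matrix.IsHermitian, Matrix.conjTranspose_mul, Matrix.conjTranspose_mul,
    (reflMat_isHermitian z).eq, hA.eq, mul_assoc]

lemma reflMat_conj_conj {n : ℕ} (z : Fin n → ℂ) (A : BlockMat n) :
    reflMat z * (reflMat z * A * reflMat z) * reflMat z = A := by
  have hz := reflMat_mul_self z
  rw [mul_assoc, mul_assoc, hz, mul_one, ← mul_assoc, hz, one_mul]

lemma toBlock_conjMap {n : ℕ} (y : BlockCoord n) :
    toBlock (conjMap y) = reflMat y.2.1 * diagBlock y * reflMat y.2.1 :=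
  toBlock_fromBlock (reflMat_conj_isHermitian _ (diagBlock_isHermitian y))

lemma charpoly_toBlock_conjMap {n : ℕ} (y : BlockCoord n) :
    (toBlock (conjMap y)).charpoly = (X - C (y.1 : ℂ)) * (toMat y.2.2).charpoly := by
  rw [toBlock_conjMap, Matrix.charpoly_mul_comm, ← mul_assoc, reflMat_mul_self, one_mul]
  have h : diagBlock y = Matrix.fromBlocks (Matrix.of fun _ _ => (y.1 : ℂ)) 0
      (Matrix.of fun i _ => 0) (toMat y.2.2) := by
    ext (i | i) (j | j) <;> simp [diagBlock_apply]
  rw [h, Matrix.charpoly_fromBlocks_zero₁₂]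
  congr 1
  simp [Matrix.charpoly, Matrix.det_unique]

/-- Reading a matrix with distinguished first row and column as an `(n + 1) × (n + 1)` matrix. -/
def joinIndex (n : ℕ) : Unit ⊕ Fin n ≃ Fin (n + 1) :=
  Fintype.equivOfCardEq (by simp [add_comm])

/-- The passage from block coordinates to coordinates. -/
def joinCoord (n : ℕ) : BlockCoord n ≃ₗ[ℝ] Coord (n + 1) where
  toFun y := fromMat ((toBlock y).submatrix (joinIndex n).symm (joinIndex n).symm)
  invFun x := fromBlock ((toMat x).submatrix (joinIndex n) (joinIndex n))
  map_add' x y := by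
    rw [map_add, Matrix.submatrix_add, Pi.add_apply, Pi.add_apply, map_add]
  map_smul' c x := by
    rw [map_smul, Matrix.submatrix_smul, Pi.smul_apply, Pi.smul_apply, map_smul]
    rfl
  left_inv y := by
    change fromBlock ((toMat (fromMat _)).submatrix _ _) = y
    rw [toMat_fromMat ((toBlock_isHermitian y).submatrix _)]
    simp [fromBlock_toBlock]
  right_inv x := by
    change fromMat ((toBlock (fromBlock _)).submatrix _ _) = x
    rw [toBlock_fromBlock ((toMat_isHermitian x).submatrix _)]
    simp [fromMat_toMat]

lemma charpoly_joinCoord {n : ℕ} (y : BlockCoord n) :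
    (hermOfCoords (joinCoord n y)).1.charpoly = (toBlock y).charpoly := by
  have h : (hermOfCoords (joinCoord n y)).1 =
      (toBlock y).submatrix (joinIndex n).symm (joinIndex n).symm :=
    toMat_fromMat ((toBlock_isHermitian y).submatrix _)
  rw [h]
  exact Matrix.charpoly_reindex (joinIndex n) (toBlock y)

lemma sortedEigenvalues_join_conjMap {n : ℕ} {y : BlockCoord n}
    (hy : ∀ i, sortedEigenvalues (hermOfCoords y.2.2) i < y.1) :
    sortedEigenvalues (hermOfCoords (joinCoord n (conjMap y))) =
      Fin.cons y.1 (sortedEigenvalues (hermOfCoords y.2.2)) := by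
  refine sortedEigenvalues_eq ?_ ?_
  · intro i j hij
    induction i using Fin.cases with
    | zero =>
      induction j using Fin.cases with
      | zero => exact le_rfl
      | succ j => simpa using (hy j).le
    | succ i =>
      induction j using Fin.cases with
      | zero => simp at hij
      | succ j => simpa using sortedEigenvalues_antitone _ (Fin.succ_le_succ_iff.1 hij)
  · rw [charpoly_joinCoord, charpoly_toBlock_conjMap, Fin.prod_univ_succ]
    simp only [Fin.cons_zero, Fin.cons_succ]
    rw [← charpoly_eq_prod_sortedEigenvalues]
    rfl

lemma scalar_sub_mulVec {n : ℕ} (c : ℂ) (B : Matrix (Fin n) (Fin n) ℂ) (v : Fin n → ℂ) :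
    (Matrix.scalar (Fin n) c - B).mulVec v = c • v - B.mulVec v := by
  rw [Matrix.sub_mulVec, Matrix.scalar_apply, ← Matrix.smul_one_eq_diagonal, Matrix.smul_mulVec,
    Matrix.one_mulVec]

/-- If `a` exceeds the eigenvalues of `B`, then the eigenvectors of `a ⊕ B` for `a` are the
multiples of the first basis vector. -/
lemma lower_eq_zero_of_diagBlock_mulVec {n : ℕ} {y : BlockCoord n}
    (hy : ∀ i, sortedEigenvalues (hermOfCoords y.2.2) i < y.1) {v : Unit ⊕ Fin n → ℂ}
    (hv : (diagBlock y).mulVec v = (y.1 : ℂ) • v) (i : Fin n) : v (.inr i) = 0 := by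
  have hdet : (Matrix.scalar (Fin n) (y.1 : ℂ) - toMat y.2.2).det ≠ 0 := by
    rw [show toMat y.2.2 = (hermOfCoords y.2.2).1 from rfl, charpoly_eval_sub,
      Finset.prod_ne_zero_iff]
    intro i _
    exact sub_ne_zero.2 (by exact_mod_cast (hy i).ne')
  have h := Matrix.eq_zero_of_mulVec_eq_zero hdet (v := fun i => v (.inr i)) (by
    rw [scalar_sub_mulVec, sub_eq_zero]
    ext i
    simpa [Matrix.mulVec, dotProduct, diagBlock_apply] using (congrFun hv (.inr i)).symm)
  exact congrFun h i

lemma reflMat_inl_inl {n : ℕ} (z : Fin n → ℂ) (i j : Unit) :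
    reflMat z (.inl i) (.inl j) = 1 - 2 / (1 + (normSum z : ℂ)) := by
  simp [reflMat, Matrix.vecMulVec_apply, reflVec]

lemma reflMat_inr_inl {n : ℕ} (z : Fin n → ℂ) (i : Fin n) (j : Unit) :
    reflMat z (.inr i) (.inl j) = 2 / (1 + (normSum z : ℂ)) * z i := by
  simp [reflMat, Matrix.vecMulVec_apply, reflVec]

/-- The map `z ↦ z / (1 - |z|²)` is injective on the unit ball. -/
lemma eq_of_proportional {n : ℕ} {z z' : Fin n → ℂ} (hz : normSum z < 1) (hz' : normSum z' < 1)
    (h : ∀ i, ((1 - normSum z' : ℝ) : ℂ) * z i = ((1 - normSum z : ℝ) : ℂ) * z' i) : z = z' := by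
  have h1 : (1 - normSum z') ^ 2 * normSum z = (1 - normSum z) ^ 2 * normSum z' := by
    conv_lhs => rw [normSum.eq_def z]
    conv_rhs => rw [normSum.eq_def z']
    rw [Finset.mul_sum, Finset.mul_sum]
    refine Finset.sum_congr rfl fun i _ => ?_
    have := congrArg Complex.normSq (h i)
    simpa only [map_mul, Complex.normSq_ofReal, ← sq] using this
  have h0 := normSum_nonneg z
  have h0' := normSum_nonneg z'
  have h2 : normSum z = normSum z' := by
    have h3 : (normSum z - normSum z') * (1 - normSum z * normSum z') = 0 := by
      linear_combination h1
    rcases mul_eq_zero.1 h3 with h3 | h3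
    · linarith
    · nlinarith
  ext i
  have := h i
  rw [h2] at this
  exact mul_left_cancel₀ (by exact_mod_cast (sub_pos.2 hz').ne') this

/-- If two parameters give the same matrix and the same top eigenvalue, then the first columns of
the two reflections are both eigenvectors for that simple eigenvalue, hence proportional. -/
lemma exists_reflMat_col_eq_smul {n : ℕ} {y y' : BlockCoord n} (ha : y.1 = y'.1)
    (hy : ∀ i, sortedEigenvalues (hermOfCoords y'.2.2) i < y'.1)
    (hA : reflMat y.2.1 * diagBlock y * reflMat y.2.1 =
      reflMat y'.2.1 * diagBlock y' * reflMat y'.2.1) :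
    ∃ c : ℂ, ∀ i, reflMat y.2.1 i (.inl ()) = c * reflMat y'.2.1 i (.inl ()) := by
  have hR := reflMat_mul_self y.2.1
  have hR' := reflMat_mul_self y'.2.1
  set R := reflMat y.2.1
  set R' := reflMat y'.2.1
  set v := (R' * R).mulVec (Pi.single (.inl ()) 1) with hvdef
  have he : (diagBlock y).mulVec (Pi.single (.inl ()) 1) = (y.1 : ℂ) • Pi.single (.inl ()) 1 := by
    ext (i | i) <;> simp [diagBlock_apply]
  have hv : (diagBlock y').mulVec v = (y'.1 : ℂ) • v := by
    have h1 : diagBlock y' * (R' * R) = R' * R * diagBlock y := by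
      calc _ = R' * (R' * diagBlock y' * R') * R := by
            simp only [← mul_assoc, hR', one_mul]
        _ = _ := by
            rw [← hA]
            simp only [mul_assoc, hR, mul_one]
    rw [hvdef, Matrix.mulVec_mulVec, h1, ← Matrix.mulVec_mulVec, he, Matrix.mulVec_smul, ha]
  have hlow := lower_eq_zero_of_diagBlock_mulVec hy hv
  have h1 : v = v (.inl ()) • Pi.single (.inl ()) 1 := by
    ext (i | i)
    · simp
    · simpa using hlow i
  have hcol : R.mulVec (Pi.single (.inl ()) 1) =
      v (.inl ()) • R'.mulVec (Pi.single (.inl ()) 1) := by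
    rw [← Matrix.mulVec_smul, ← h1, hvdef, Matrix.mulVec_mulVec, ← mul_assoc, hR', one_mul]
  refine ⟨v (.inl ()), fun i => ?_⟩
  simpa only [Matrix.mulVec_single_one, Matrix.col_apply, Pi.smul_apply, smul_eq_mul] using
    congrFun hcol i

lemma injOn_conjMap {n : ℕ} : Set.InjOn (conjMap (n := n)) (topDomain n) := by
  intro y hy y' hy' h
  have hspec := congrArg (fun y => sortedEigenvalues (hermOfCoords (joinCoord n y))) h
  simp only [sortedEigenvalues_join_conjMap hy.2, sortedEigenvalues_join_conjMap hy'.2] at hspec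
  have ha : y.1 = y'.1 := (Fin.cons_inj.1 hspec).1
  have hA := congrArg toBlock h
  rw [toBlock_conjMap, toBlock_conjMap] at hA
  obtain ⟨c, hc⟩ := exists_reflMat_col_eq_smul ha hy'.2 hA
  have hs := one_add_normSum_ne_zero y.2.1
  have hs' := one_add_normSum_ne_zero y'.2.1
  have hz : y.2.1 = y'.2.1 := by
    refine eq_of_proportional hy.1 hy'.1 fun i => ?_
    have h0 := hc (.inl ())
    have hi := hc (.inr i)
    rw [reflMat_inl_inl, reflMat_inl_inl] at h0
    rw [reflMat_inr_inl, reflMat_inr_inl] at hi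
    push_cast
    generalize (normSum y.2.1 : ℂ) = s at *
    generalize (normSum y'.2.1 : ℂ) = s' at *
    field_simp at h0 hi
    refine mul_left_cancel₀ hs' ?_
    linear_combination (1 - s') * hi + y'.2.1 i * h0
  have hB : diagBlock y = diagBlock y' := by
    rw [← reflMat_conj_conj y.2.1 (diagBlock y), hA, hz, reflMat_conj_conj]
  rw [diagBlock_apply, diagBlock_apply] at hB
  have hx := @toBlock_injective n (y.1, 0, y.2.2) (y'.1, 0, y'.2.2) hB
  exact Prod.ext ha (Prod.ext hz (congrArg (fun q => q.2.2) hx))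

/-- The matrix with columns `z, B z, …, B ^ (n - 1) z`. -/
def krylov {n : ℕ} (y : (Fin n → ℂ) × Coord n) : Matrix (Fin n) (Fin n) ℂ :=
  Matrix.of fun i k => (toMat y.2 ^ (k : ℕ)).mulVec y.1 i

/-- If the vectors `Bᵏ z` span, then no eigenvector of `[[a, zᴴ], [z, B]]` has first entry `0`: its
remaining entries would form an eigenvector of `B` orthogonal to `z`. -/
lemma eq_zero_of_krylov {n : ℕ} {y : BlockCoord n} (hy : (krylov y.2).det ≠ 0) {c : ℂ}
    {w : Unit ⊕ Fin n → ℂ} (hw : (toBlock y).mulVec w = c • w) (h0 : w (.inl ()) = 0) : w = 0 := by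
  let u : Fin n → ℂ := fun i => w (.inr i)
  have hz : star y.2.1 ⬝ᵥ u = 0 := by
    have := congrFun hw (.inl ())
    simpa [Matrix.mulVec, dotProduct, h0, u] using this
  have hu : (toMat y.2.2).mulVec u = c • u := by
    ext i
    have := congrFun hw (.inr i)
    simpa [Matrix.mulVec, dotProduct, h0, u] using this
  have hpow (k : ℕ) : (toMat y.2.2 ^ k).mulVec u = c ^ k • u := by
    induction k with
    | zero => simp
    | succ k ih => rw [pow_succ, ← Matrix.mulVec_mulVec, hu, Matrix.mulVec_smul, ih, smul_smul,
        pow_succ']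
  have hk : Matrix.vecMul (star u) (krylov y.2) = 0 := by
    ext k
    have h1 : Matrix.vecMul (star u) (krylov y.2) k =
        star u ⬝ᵥ (toMat y.2.2 ^ (k : ℕ)).mulVec y.2.1 := rfl
    have h2 := (toMat_isHermitian y.2.2).pow k
    rw [h1, Matrix.dotProduct_mulVec, ← h2.eq, ← Matrix.star_mulVec, hpow, star_smul,
      smul_dotProduct, Matrix.star_dotProduct, hz]
    simp
  have hu0 := Matrix.eq_zero_of_vecMul_eq_zero hy hk
  ext (i | i)
  · exact h0
  · simpa [u] using congrFun hu0 i

/-- A matrix none of whose eigenvectors has first entry `0` has a simple top eigenvalue, which can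
be split off by a reflection. -/
lemma mem_image_conjMap {n : ℕ} {y₀ : BlockCoord n} (hy : (krylov y₀.2).det ≠ 0) :
    y₀ ∈ conjMap '' topDomain n := by
  have hA := toBlock_isHermitian y₀
  obtain ⟨m, hm⟩ := Finite.exists_max hA.eigenvalues
  set t := hA.eigenvalues m
  let v : Unit ⊕ Fin n → ℂ := hA.eigenvectorBasis m
  have hv : (toBlock y₀).mulVec v = (t : ℂ) • v := by
    rw [hA.mulVec_eigenvectorBasis m]
    ext; simp [t, v]
  have hnorm : ∑ i, Complex.normSq (v i) = 1 := by
    have := hA.eigenvectorBasis.orthonormal.1 m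
    rw [EuclideanSpace.norm_eq, Real.sqrt_eq_one] at this
    simpa [Complex.normSq_eq_norm_sq] using this
  have hv0 : v (.inl ()) ≠ 0 := fun h => by
    rw [eq_zero_of_krylov hy hv h] at hnorm
    simp at hnorm
  -- normalize the eigenvector to have negative first entry `-κ`
  set κ : ℝ := ‖v (.inl ())‖ with hκ
  have hκ0 : 0 < κ := norm_pos_iff.2 hv0
  let u : ℂ := -(star (v (.inl ())) / κ)
  let w : Unit ⊕ Fin n → ℂ := u • v
  have hw : (toBlock y₀).mulVec w = (t : ℂ) • w := by
    simp only [w]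
    rw [Matrix.mulVec_smul, hv, smul_comm]
  have hκc : (κ : ℂ) ≠ 0 := by exact_mod_cast hκ0.ne'
  have hw0 : w (.inl ()) = -(κ : ℂ) := by
    simp only [w, u, Pi.smul_apply, smul_eq_mul]
    have : star (v (.inl ())) * v (.inl ()) = (κ : ℂ) ^ 2 := Complex.conj_mul' _
    field_simp
    rw [this]
  have hu : Complex.normSq u = 1 := by
    have h1 : Complex.normSq (v (.inl ())) = κ ^ 2 := Complex.normSq_eq_norm_sq _
    have h2 : Complex.normSq (star (v (.inl ()))) = κ ^ 2 := (Complex.normSq_conj _).trans h1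
    simp only [u, Complex.normSq_neg, Complex.normSq_div, h2, Complex.normSq_ofReal]
    field_simp
  have hwn : ∑ i, Complex.normSq (w (.inr i)) = 1 - κ ^ 2 := by
    have h1 : ∑ i, Complex.normSq (w i) = 1 := by simp [w, hu, hnorm]
    rw [Fintype.sum_sum_type] at h1
    simp [hw0] at h1
    linarith
  -- the solution of `R(z) e₀ = w`, as `|z|² = (1 - κ) / (1 + κ)`
  let z : Fin n → ℂ := fun i => w (.inr i) / ((1 + κ : ℝ) : ℂ)
  have hz : normSum z = (1 - κ) / (1 + κ) := by
    simp only [normSum, z, Complex.normSq_div, Complex.normSq_ofReal]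
    rw [← Finset.sum_div, hwn]
    field_simp
    ring
  have hcol : (reflMat z).mulVec (Pi.single (.inl ()) 1) = w := by
    have h1 : (1 : ℂ) + κ ≠ 0 := by exact_mod_cast (by positivity : (0 : ℝ) < 1 + κ).ne'
    have hρ : 2 / (1 + ((1 : ℂ) - κ) / (1 + κ)) = 1 + κ := by
      rw [show 1 + ((1 : ℂ) - κ) / (1 + κ) = 2 / (1 + κ) by field_simp; ring]
      field_simp
    ext (i | i)
    · simp only [Matrix.mulVec_single_one, Matrix.col_apply, reflMat_inl_inl, hz, hw0]
      push_cast
      rw [hρ]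
      ring
    · simp only [Matrix.mulVec_single_one, Matrix.col_apply, reflMat_inr_inl, hz, z]
      push_cast
      rw [hρ]
      field_simp
  have hR := reflMat_mul_self z
  set H := reflMat z * toBlock y₀ * reflMat z with hHdef
  have hH : H.IsHermitian := reflMat_conj_isHermitian z hA
  have hHe : H.mulVec (Pi.single (.inl ()) 1) = (t : ℂ) • Pi.single (.inl ()) 1 := by
    rw [hHdef, ← Matrix.mulVec_mulVec, hcol, ← Matrix.mulVec_mulVec, hw, Matrix.mulVec_smul, ← hcol,
      Matrix.mulVec_mulVec, hR, Matrix.one_mulVec]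
  let y : BlockCoord n := (t, z, (fromBlock H).2.2)
  have hdiag : diagBlock y = H := by
    rw [← toBlock_fromBlock hH]
    have h1 := congrFun hHe (.inl ())
    have h2 := fun i => congrFun hHe (.inr i)
    simp only [Matrix.mulVec_single_one, Matrix.col_apply] at h1 h2
    refine congrArg toBlock (Prod.ext ?_ (Prod.ext ?_ rfl))
    · simp [y, fromBlock, h1]
    · ext i
      simp [fromBlock, h2]
  have himg : conjMap y = y₀ := by
    rw [conjMap, hdiag, hHdef]
    change fromBlock (reflMat z * (reflMat z * toBlock y₀ * reflMat z) * reflMat z) = y₀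
    rw [reflMat_conj_conj, fromBlock_toBlock]
  refine ⟨y, ⟨?_, fun i => ?_⟩, himg⟩
  · change normSum z < 1
    rw [hz, div_lt_one (by positivity)]
    linarith
  · by_contra! hi
    set q := sortedEigenvalues (hermOfCoords y.2.2) i with hq
    have hdet : (Matrix.scalar (Fin n) (q : ℂ) - toMat y.2.2).det = 0 := by
      rw [show toMat y.2.2 = (hermOfCoords y.2.2).1 from rfl, charpoly_eval_sub]
      exact Finset.prod_eq_zero (Finset.mem_univ i) (by simp [hq])
    obtain ⟨b, hb0, hb⟩ := Matrix.exists_mulVec_eq_zero_iff.2 hdet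
    let b' : Unit ⊕ Fin n → ℂ := Sum.elim 0 b
    have hb' : H.mulVec b' = (q : ℂ) • b' := by
      rw [← hdiag]
      ext (j | j)
      · simp [Matrix.mulVec, dotProduct, b', diagBlock_apply]
      · rw [scalar_sub_mulVec, sub_eq_zero] at hb
        simpa [b', Matrix.mulVec, dotProduct, diagBlock_apply] using (congrFun hb j).symm
    have hAb : (toBlock y₀).mulVec ((reflMat z).mulVec b') = (q : ℂ) • (reflMat z).mulVec b' := by
      have h1 : toBlock y₀ * reflMat z = reflMat z * H := by
        rw [hHdef, ← mul_assoc, ← mul_assoc, hR, one_mul]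
      rw [Matrix.mulVec_mulVec, h1, ← Matrix.mulVec_mulVec, hb', Matrix.mulVec_smul]
    have hqt : q = t := by
      have h1 := charpoly_toBlock_conjMap y
      rw [himg, hA.charpoly_eq] at h1
      have h2 := congrArg (eval (q : ℂ)) h1
      rw [eval_mul, Matrix.eval_charpoly, hdet, mul_zero, eval_prod, Finset.prod_eq_zero_iff] at h2
      obtain ⟨j, -, hj⟩ := h2
      have h3 : q = hA.eigenvalues j := by
        rw [eval_sub, eval_X, eval_C, sub_eq_zero] at hj
        exact Complex.ofReal_injective hj
      exact le_antisymm (h3 ▸ hm j) hi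
    -- a combination of two eigenvectors for the top eigenvalue has first entry `0`
    rw [hqt] at hAb
    let p : Unit ⊕ Fin n → ℂ :=
      (reflMat z).mulVec b' (.inl ()) • Pi.single (.inl ()) 1 + (κ : ℂ) • b'
    have hp : (toBlock y₀).mulVec ((reflMat z).mulVec p) = (t : ℂ) • (reflMat z).mulVec p := by
      simp only [p, Matrix.mulVec_add, Matrix.mulVec_smul, hcol, hAb, hw]
      module
    have hp0 : (reflMat z).mulVec p = 0 := eq_zero_of_krylov hy hp (by
      simp only [p, Matrix.mulVec_add, Matrix.mulVec_smul, hcol, Pi.add_apply, Pi.smul_apply, hw0,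
        smul_eq_mul]
      ring)
    have hp1 : p = 0 := by
      rw [← Matrix.one_mulVec p, ← hR, ← Matrix.mulVec_mulVec, hp0, Matrix.mulVec_zero]
    refine hb0 (funext fun j => ?_)
    have := congrFun hp1 (.inr j)
    simpa [p, b', hκ0.ne'] using this

/-! ### Generic matrices -/

/-- In an eigenbasis of `B` the matrix with columns `Bᵏ z` is the product of the diagonal matrix of
the coordinates of `z` and a Vandermonde matrix. -/
lemma krylov_det_ne_zero {n : ℕ} {z : Fin n → ℂ} {x : Coord n}
    (hx : Function.Injective (hermOfCoords x).2.eigenvalues)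
    (hz : ∀ i, (star ((hermOfCoords x).2.eigenvectorUnitary : Matrix (Fin n) (Fin n) ℂ)).mulVec z i
      ≠ 0) : (krylov (z, x)).det ≠ 0 := by
  set hA := (hermOfCoords x).2 with hAdef
  set U : Matrix (Fin n) (Fin n) ℂ := (hA.eigenvectorUnitary : Matrix (Fin n) (Fin n) ℂ) with hU
  set c := (star U).mulVec z with hc
  have hUU : U * star U = 1 := Unitary.mul_star_self_of_mem hA.eigenvectorUnitary.2
  have hpow (k : ℕ) : toMat x ^ k =
      U * Matrix.diagonal (fun i => (hA.eigenvalues i : ℂ) ^ k) * star U := by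
    have h1 : toMat x = _ := hA.spectral_theorem
    rw [h1, ← map_pow, Unitary.conjStarAlgAut_apply, Matrix.diagonal_pow]
    rfl
  have hK : krylov (z, x) = U * Matrix.diagonal c *
      Matrix.vandermonde (fun i => (hA.eigenvalues i : ℂ)) := by
    ext i k
    change (toMat x ^ (k : ℕ)).mulVec z i = _
    rw [hpow, ← Matrix.mulVec_mulVec, ← hc, ← Matrix.mulVec_mulVec, mul_assoc]
    simp [Matrix.mulVec, dotProduct, Matrix.mul_apply, Matrix.diagonal_apply,
      Matrix.vandermonde_apply, mul_comm]
  rw [hK, Matrix.det_mul, Matrix.det_mul, Matrix.det_diagonal]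
  refine mul_ne_zero (mul_ne_zero ?_ (Finset.prod_ne_zero_iff.2 fun i _ => hz i))
    (Matrix.det_vandermonde_ne_zero_iff.2 fun i j hij => hx (Complex.ofReal_injective hij))
  exact left_ne_zero_of_mul_eq_one (b := (star U).det)
    (by rw [← Matrix.det_mul, hUU, Matrix.det_one])

lemma continuous_toMat {n : ℕ} : Continuous (toMat (n := n)) :=
  continuous_subtype_val.comp continuous_hermOfCoords

lemma measurableSet_krylov {n : ℕ} :
    MeasurableSet {q : (Fin n → ℂ) × Coord n | (krylov q).det ≠ 0} := by
  have h : Continuous fun q : (Fin n → ℂ) × Coord n => (krylov q).det := by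
    refine Continuous.matrix_det (continuous_matrix fun i k => ?_)
    have h1 : Continuous fun q : (Fin n → ℂ) × Coord n => (toMat q.2 ^ (k : ℕ)).mulVec q.1 :=
      ((continuous_toMat.comp continuous_snd).pow _).matrix_mulVec continuous_fst
    exact (continuous_apply i).comp h1
  exact (h.isOpen_preimage _ isOpen_compl_singleton).measurableSet

lemma ae_krylov {n : ℕ} {x : Coord n} (hx : Function.Injective (hermOfCoords x).2.eigenvalues) :
    ∀ᵐ z : Fin n → ℂ, (krylov (z, x)).det ≠ 0 := by
  set U : Matrix (Fin n) (Fin n) ℂ :=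
    ((hermOfCoords x).2.eigenvectorUnitary : Matrix (Fin n) (Fin n) ℂ) with hU
  have hUU : star U * U = 1 := Unitary.star_mul_self_of_mem (hermOfCoords x).2.eigenvectorUnitary.2
  have h : ∀ᵐ z : Fin n → ℂ, ∀ i, (star U).mulVec z i ≠ 0 := by
    refine ae_all_iff.2 fun i => ?_
    let T : (Fin n → ℂ) →ₗ[ℝ] ℂ :=
      (LinearMap.proj i ∘ₗ Matrix.toLin' (star U)).restrictScalars ℝ
    have hT : LinearMap.ker T ≠ ⊤ := fun h => by
      have h1 : T (U.mulVec (Pi.single i 1)) = 0 := by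
        rw [← LinearMap.mem_ker, h]
        trivial
      simp [T, Matrix.mulVec_mulVec, hUU, - Matrix.mulVec_single] at h1
    exact measure_mono_null (fun z hz => by simpa [T] using hz)
      (Measure.addHaar_submodule volume _ hT)
  filter_upwards [h] with z hz
  exact krylov_det_ne_zero hx hz

/-! ### The Weyl integration formula -/

/-- The squared Vandermonde determinant. -/
def vandermondeSq {n : ℕ} (t : Fin n → ℝ) : ℝ := (Matrix.vandermonde t).det ^ 2

lemma vandermondeSq_cons {n : ℕ} (a : ℝ) (t : Fin n → ℝ) :
    vandermondeSq (Fin.cons a t : Fin (n + 1) → ℝ) = (∏ i, (a - t i) ^ 2) * vandermondeSq t := by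
  rw [vandermondeSq, vandermondeSq, Matrix.det_vandermonde, Matrix.det_vandermonde,
    Fin.prod_univ_succ, mul_pow]
  congr 1
  · rw [Fin.prod_Ioi_zero, ← Finset.prod_pow]
    exact Finset.prod_congr rfl fun i _ => by simp; ring
  · simp [Fin.prod_Ioi_succ]

lemma continuous_vandermondeSq {n : ℕ} : Continuous (vandermondeSq (n := n)) := by
  unfold vandermondeSq
  simp only [Matrix.det_vandermonde]
  fun_prop

/-- The strictly decreasing tuples. -/
def chamber (n : ℕ) : Set (Fin n → ℝ) := {t | StrictAnti t}

lemma measurableSet_chamber {n : ℕ} : MeasurableSet (chamber n) := by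
  have h : chamber n = ⋂ i, ⋂ j, ⋂ _ : i < j, {t : Fin n → ℝ | t j < t i} := by
    ext t
    simp only [chamber, StrictAnti, Set.mem_iInter, Set.mem_ofPred_eq]
  rw [h]
  exact MeasurableSet.iInter fun i => MeasurableSet.iInter fun j => MeasurableSet.iInter fun _ =>
    measurableSet_lt (measurable_pi_apply j) (measurable_pi_apply i)

lemma cons_mem_chamber {n : ℕ} {a : ℝ} {t : Fin n → ℝ} :
    (Fin.cons a t : Fin (n + 1) → ℝ) ∈ chamber (n + 1) ↔ (∀ i, t i < a) ∧ t ∈ chamber n := by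
  constructor
  · intro h
    exact ⟨fun i => by simpa using h (Fin.succ_pos i),
      fun i j hij => by simpa using h (Fin.succ_lt_succ_iff.2 hij)⟩
  · rintro ⟨h1, h2⟩ i j hij
    induction i using Fin.cases with
    | zero =>
      obtain ⟨k, rfl⟩ := Fin.exists_succ_eq.2 hij.ne'
      simpa using h1 k
    | succ i =>
      obtain ⟨k, rfl⟩ := Fin.exists_succ_eq.2 ((Fin.succ_pos i).trans hij).ne'
      simpa using h2 (Fin.succ_lt_succ_iff.1 hij)

/-- The Weyl integration formula with constant `C`: the sorted eigenvalues of a Hermitian matrix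
have density proportional to the squared Vandermonde determinant under Lebesgue measure. -/
def WeylFormula (n : ℕ) (C : ℝ≥0∞) : Prop :=
  ∀ F : (Fin n → ℝ) → ℝ≥0∞, Measurable F →
    ∫⁻ x : Coord n, F (sortedEigenvalues (hermOfCoords x)) =
      C * ∫⁻ t in chamber n, F t * ENNReal.ofReal (vandermondeSq t)

lemma measurable_eigs {n : ℕ} :
    Measurable fun x : Coord n => sortedEigenvalues (hermOfCoords x) :=
  measurable_sortedEigenvalues.comp continuous_hermOfCoords.measurable

lemma WeylFormula.ae_injective {n : ℕ} {C : ℝ≥0∞} (h : WeylFormula n C) :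
    ∀ᵐ x : Coord n, Function.Injective (hermOfCoords x).2.eigenvalues := by
  have hm : MeasurableSet (chamber n)ᶜ := measurableSet_chamber.compl
  have h1 := h ((chamber n)ᶜ.indicator 1) (measurable_one.indicator hm)
  have h2 : ∫⁻ t in chamber n,
      (chamber n)ᶜ.indicator 1 t * ENNReal.ofReal (vandermondeSq t) = 0 := by
    rw [setLIntegral_congr_fun (g := 0) measurableSet_chamber]
    · simp
    · intro t ht
      simp [ht]
  rw [h2, mul_zero] at h1
  have h1' := (lintegral_eq_zero_iff
    (f := fun x : Coord n => (chamber n)ᶜ.indicator 1 (sortedEigenvalues (hermOfCoords x)))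
    ((measurable_one.indicator hm).comp measurable_eigs)).1 h1
  filter_upwards [h1'] with x hx
  rw [injective_sortedEigenvalues_iff]
  have h3 : sortedEigenvalues (hermOfCoords x) ∈ chamber n := by
    by_contra h4
    have h5 : sortedEigenvalues (hermOfCoords x) ∈ (chamber n)ᶜ := h4
    simp [Set.indicator_of_mem h5] at hx
  exact StrictAnti.injective h3

lemma measurableSet_topDomain {n : ℕ} : MeasurableSet (topDomain n) := by
  have h1 : MeasurableSet {y : BlockCoord n | normSum y.2.1 < 1} :=
    measurableSet_lt (contDiff_normSum.continuous.measurable.comp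
      (measurable_fst.comp measurable_snd)) measurable_const
  have h2 : MeasurableSet {y : BlockCoord n |
      ∀ i, sortedEigenvalues (hermOfCoords y.2.2) i < y.1} := by
    simp only [Set.ofPred_forall]
    exact MeasurableSet.iInter fun i => measurableSet_lt ((measurable_pi_apply i).comp
      (measurable_eigs.comp (measurable_snd.comp measurable_snd))) measurable_fst
  exact h1.inter h2

lemma WeylFormula.ae_mem_image {n : ℕ} {C : ℝ≥0∞} (h : WeylFormula n C) :
    ∀ᵐ y : BlockCoord n, y ∈ conjMap '' topDomain n := by
  have h1 : ∀ᵐ q : (Fin n → ℂ) × Coord n, (krylov q).det ≠ 0 := by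
    rw [Measure.volume_eq_prod, Measure.ae_prod_iff_ae_ae measurableSet_krylov,
      Measure.ae_ae_comm measurableSet_krylov]
    filter_upwards [h.ae_injective] with x hx
    exact ae_krylov hx
  have h2 : ∀ᵐ y : BlockCoord n, (krylov y.2).det ≠ 0 :=
    Measure.quasiMeasurePreserving_snd.ae h1
  filter_upwards [h2] with y hy
  exact mem_image_conjMap hy

instance instBorelSpaceBlockCoord (n : ℕ) : BorelSpace (BlockCoord n) :=
  have : BorelSpace ((Fin n → ℂ) × Coord n) := Prod.borelSpace
  Prod.borelSpace

instance instIsAddHaarMeasureCoord (n : ℕ) :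
    Measure.IsAddHaarMeasure (volume : Measure (Coord n)) :=
  Measure.prod.instIsAddHaarMeasure _ _

instance instIsAddHaarMeasureBlockCoord (n : ℕ) :
    Measure.IsAddHaarMeasure (volume : Measure (BlockCoord n)) :=
  have : BorelSpace ((Fin n → ℂ) × Coord n) := Prod.borelSpace
  have : Measure.IsAddHaarMeasure (volume : Measure ((Fin n → ℂ) × Coord n)) :=
    Measure.prod.instIsAddHaarMeasure _ _
  Measure.prod.instIsAddHaarMeasure _ _

/-- The change of variables `conjMap`, which covers almost all matrices once. -/
lemma WeylFormula.lintegral_blockCoord {n : ℕ} {C : ℝ≥0∞} (h : WeylFormula n C)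
    (F : (Fin (n + 1) → ℝ) → ℝ≥0∞) :
    ∫⁻ y : BlockCoord n, F (sortedEigenvalues (hermOfCoords (joinCoord n y))) =
      ∫⁻ y in topDomain n, ENNReal.ofReal (|LinearMap.det (lineDeriv y.2.1)| *
        ∏ i, (y.1 - sortedEigenvalues (hermOfCoords y.2.2) i) ^ 2) *
        F (Fin.cons y.1 (sortedEigenvalues (hermOfCoords y.2.2))) := by
  choose f hf hdet using exists_hasFDerivAt_conjMap_det (n := n)
  have hae : ∫⁻ y : BlockCoord n, F (sortedEigenvalues (hermOfCoords (joinCoord n y))) =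
      ∫⁻ y in conjMap '' topDomain n, F (sortedEigenvalues (hermOfCoords (joinCoord n y))) := by
    rw [Measure.restrict_eq_self_of_ae_mem h.ae_mem_image]
  rw [hae,
    lintegral_image_eq_lintegral_abs_det_fderiv_mul volume measurableSet_topDomain
      (fun y _ => (hf y).hasFDerivWithinAt) injOn_conjMap]
  refine setLIntegral_congr_fun measurableSet_topDomain fun y hy => ?_
  simp only [hdet, sortedEigenvalues_join_conjMap hy.2]

/-- The eigenvalues of the block `B` are integrated out by the formula one dimension lower; the
variable `z` only contributes a constant. -/
lemma WeylFormula.lintegral_topDomain {n : ℕ} {C : ℝ≥0∞} (h : WeylFormula n C)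
    {F : (Fin (n + 1) → ℝ) → ℝ≥0∞} (hF : Measurable F) :
    ∫⁻ y in topDomain n, ENNReal.ofReal (|LinearMap.det (lineDeriv y.2.1)| *
        ∏ i, (y.1 - sortedEigenvalues (hermOfCoords y.2.2) i) ^ 2) *
        F (Fin.cons y.1 (sortedEigenvalues (hermOfCoords y.2.2))) =
      (∫⁻ z in {z : Fin n → ℂ | normSum z < 1}, ENNReal.ofReal |LinearMap.det (lineDeriv z)|) * C *
        ∫⁻ t in chamber (n + 1), F t * ENNReal.ofReal (vandermondeSq t) := by
  set B : Set (Fin n → ℂ) := {z | normSum z < 1}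
  have hB : MeasurableSet B := measurableSet_lt contDiff_normSum.continuous.measurable
    measurable_const
  let J : (Fin n → ℂ) → ℝ≥0∞ := B.indicator fun z => ENNReal.ofReal |LinearMap.det (lineDeriv z)|
  have hJ : Measurable J := (continuous_det_lineDeriv.abs.measurable.ennreal_ofReal).indicator hB
  let S : Set (ℝ × (Fin n → ℝ)) := {p | ∀ i, p.2 i < p.1}
  have hS : MeasurableSet S := by
    simp only [S, Set.ofPred_forall]
    exact MeasurableSet.iInter fun i => measurableSet_lt
      ((measurable_pi_apply i).comp measurable_snd) measurable_fst
  have hcons : Measurable fun p : ℝ × (Fin n → ℝ) => (Fin.cons p.1 p.2 : Fin (n + 1) → ℝ) := by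
    refine measurable_pi_lambda _ fun i => ?_
    induction i using Fin.cases with
    | zero => simpa using measurable_fst
    | succ i => exact (measurable_pi_apply i).comp measurable_snd
  let H : ℝ × (Fin n → ℝ) → ℝ≥0∞ := S.indicator fun p =>
    ENNReal.ofReal (∏ i, (p.1 - p.2 i) ^ 2) * F (Fin.cons p.1 p.2)
  have hH : Measurable H := by
    refine Measurable.indicator (Measurable.mul ?_ (hF.comp hcons)) hS
    exact Measurable.ennreal_ofReal (by fun_prop)
  have hHm (a : ℝ) : Measurable fun t => H (a, t) := hH.comp (by fun_prop)
  calc _ = ∫⁻ y : BlockCoord n, J y.2.1 * H (y.1, sortedEigenvalues (hermOfCoords y.2.2)) := by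
        rw [← lintegral_indicator measurableSet_topDomain]
        refine lintegral_congr fun y => ?_
        by_cases h1 : y.2.1 ∈ B
        · by_cases h2 : (y.1, sortedEigenvalues (hermOfCoords y.2.2)) ∈ S
          · simp only [J, H, Set.indicator_of_mem h1, Set.indicator_of_mem h2]
            rw [Set.indicator_of_mem (show y ∈ topDomain n from ⟨h1, h2⟩),
              ENNReal.ofReal_mul (abs_nonneg _), mul_assoc]
          · simp only [H, Set.indicator_of_notMem h2]
            rw [Set.indicator_of_notMem (fun hy : y ∈ topDomain n => h2 hy.2), mul_zero]
        · simp only [J, Set.indicator_of_notMem h1]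
          rw [Set.indicator_of_notMem (fun hy : y ∈ topDomain n => h1 hy.1), zero_mul]
    _ = ∫⁻ a : ℝ, (∫⁻ z, J z) * ∫⁻ x : Coord n, H (a, sortedEigenvalues (hermOfCoords x)) := by
        rw [Measure.volume_eq_prod, lintegral_prod]
        · refine lintegral_congr fun a => ?_
          rw [Measure.volume_eq_prod]
          exact lintegral_prod_mul (f := J)
            (g := fun x => H (a, sortedEigenvalues (hermOfCoords x))) hJ.aemeasurable
            ((hHm a).comp measurable_eigs).aemeasurable
        · refine (Measurable.mul (hJ.comp (by fun_prop)) (hH.comp ?_)).aemeasurable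
          exact measurable_fst.prodMk (measurable_eigs.comp (by fun_prop))
    _ = ∫⁻ a : ℝ, ((∫⁻ z, J z) * C) *
          ∫⁻ t in chamber n, H (a, t) * ENNReal.ofReal (vandermondeSq t) := by
        refine lintegral_congr fun a => ?_
        rw [h _ (hHm a), mul_assoc]
    _ = ((∫⁻ z, J z) * C) * ∫⁻ a : ℝ,
          ∫⁻ t in chamber n, H (a, t) * ENNReal.ofReal (vandermondeSq t) := by
        rw [lintegral_const_mul]
        exact Measurable.lintegral_prod_right' (f := fun p : ℝ × (Fin n → ℝ) =>
          H p * ENNReal.ofReal (vandermondeSq p.2)) (ν := volume.restrict (chamber n))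
          (hH.mul (continuous_vandermondeSq.measurable.comp measurable_snd).ennreal_ofReal)
    _ = _ := by
        rw [lintegral_indicator hB]
        congr 1
        have hG : Measurable ((chamber (n + 1)).indicator fun t : Fin (n + 1) → ℝ =>
            F t * ENNReal.ofReal (vandermondeSq t)) :=
          (hF.mul continuous_vandermondeSq.measurable.ennreal_ofReal).indicator
            measurableSet_chamber
        rw [← lintegral_indicator measurableSet_chamber,
          ← (volume_preserving_piFinSuccAbove (fun _ : Fin (n + 1) => ℝ) 0).symm.lintegral_comp hG,
          Measure.volume_eq_prod,
          lintegral_prod _ (by exact (hG.comp (MeasurableEquiv.measurable _)).aemeasurable)]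
        refine lintegral_congr fun a => ?_
        rw [← lintegral_indicator measurableSet_chamber]
        refine lintegral_congr fun t => ?_
        have hcons' : (MeasurableEquiv.piFinSuccAbove (fun _ : Fin (n + 1) => ℝ) 0).symm (a, t) =
            Fin.cons a t := by
          rw [MeasurableEquiv.piFinSuccAbove_symm_apply]
          exact Fin.insertNth_zero (α := fun _ => ℝ) a t
        rw [hcons']
        by_cases h1 : (a, t) ∈ S
        · by_cases h2 : t ∈ chamber n
          · rw [Set.indicator_of_mem h2, Set.indicator_of_mem (cons_mem_chamber.2 ⟨h1, h2⟩)]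
            simp only [H, Set.indicator_of_mem h1]
            rw [vandermondeSq_cons, ENNReal.ofReal_mul (by positivity)]
            ring
          · rw [Set.indicator_of_notMem h2,
              Set.indicator_of_notMem fun h3 => h2 (cons_mem_chamber.1 h3).2]
        · rw [Set.indicator_of_notMem (s := chamber (n + 1)) fun h3 => h1 (cons_mem_chamber.1 h3).1]
          have hH0 : H (a, t) = 0 := Set.indicator_of_notMem h1 _
          exact Set.indicator_apply_eq_zero.2 fun _ => by simp only [hH0, zero_mul]

/-- The contribution of `z` to the constant in the Weyl formula is finite, as the Jacobian factor is
continuous on the closed ball. -/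
lemma lintegral_lineDeriv_lt_top (n : ℕ) :
    ∫⁻ z in {z : Fin n → ℂ | normSum z < 1}, ENNReal.ofReal |LinearMap.det (lineDeriv z)| < ∞ := by
  have hsub : {z : Fin n → ℂ | normSum z < 1} ⊆ Metric.closedBall 0 1 := by
    intro z hz
    rw [mem_closedBall_zero_iff, pi_norm_le_iff_of_nonneg zero_le_one]
    intro i
    have h1 : Complex.normSq (z i) ≤ normSum z :=
      Finset.single_le_sum (f := fun i => Complex.normSq (z i))
        (fun _ _ => Complex.normSq_nonneg _) (Finset.mem_univ i)
    rw [Complex.normSq_eq_norm_sq] at h1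
    have hz : normSum z < 1 := hz
    nlinarith [norm_nonneg (z i)]
  refine (lintegral_mono_set hsub).trans_lt ?_
  have := (continuous_det_lineDeriv (n := n)).abs.continuousOn.integrableOn_compact
    (isCompact_closedBall (0 : Fin n → ℂ) 1) (μ := volume)
  exact this.lintegral_lt_top

/-- The Weyl integration formula. In the induction step, Lebesgue measure in coordinates and in
block coordinates agree up to a constant, by uniqueness of Haar measure. -/
theorem exists_weylFormula (n : ℕ) : ∃ C : ℝ≥0∞, C ≠ ∞ ∧ WeylFormula n C := by
  induction n with
  | zero =>
    refine ⟨1, ENNReal.one_ne_top, fun F _ => ?_⟩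
    have h1 (t : Fin 0 → ℝ) : F t = F 0 := congrArg F (Subsingleton.elim _ _)
    have h2 : chamber 0 = Set.univ := Set.eq_univ_of_forall fun t i => i.elim0
    simp only [h1, h2, vandermondeSq]
    have h3 : (volume : Measure (Coord 0)) Set.univ = 1 := by
      have : IsEmpty {e : Fin 0 × Fin 0 // e.1 < e.2} := ⟨fun e => e.1.1.elim0⟩
      rw [Measure.volume_eq_prod, ← Set.univ_prod_univ, Measure.prod_prod]
      simp [volume_pi]
    have h4 : (volume : Measure (Fin 0 → ℝ)) Set.univ = 1 := by simp [volume_pi]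
    simp [h3, h4]
  | succ n ih =>
    obtain ⟨C, hC, h⟩ := ih
    let L : BlockCoord n ≃L[ℝ] Coord (n + 1) := (joinCoord n).toContinuousLinearEquiv
    have hL : (volume : Measure (Coord (n + 1))) =
        Measure.addHaarScalarFactor volume ((volume : Measure (BlockCoord n)).map L) •
          (volume : Measure (BlockCoord n)).map L :=
      Measure.isAddLeftInvariant_eq_smul _ _
    generalize
      Measure.addHaarScalarFactor volume ((volume : Measure (BlockCoord n)).map L) = c at hL
    refine ⟨c * ((∫⁻ z in {z : Fin n → ℂ | normSum z < 1},
      ENNReal.ofReal |LinearMap.det (lineDeriv z)|) * C), ?_, fun F hF => ?_⟩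
    · exact ENNReal.mul_ne_top ENNReal.coe_ne_top
        (ENNReal.mul_ne_top (lintegral_lineDeriv_lt_top n).ne hC)
    · have hmap := lintegral_map (μ := volume)
        (f := fun x => F (sortedEigenvalues (hermOfCoords x))) (hF.comp measurable_eigs)
        L.continuous.measurable
      rw [hL, lintegral_smul_measure, hmap, mul_assoc, ← h.lintegral_topDomain hF,
        ← h.lintegral_blockCoord]
      rfl

/-! ### Symmetric functions on the chamber -/

lemma ae_injective_pi (n : ℕ) : ∀ᵐ t : Fin n → ℝ, Function.Injective t := by
  have h : ∀ᵐ t : Fin n → ℝ, ∀ i j, i ≠ j → t i ≠ t j := by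
    refine ae_all_iff.2 fun i => ae_all_iff.2 fun j => ?_
    by_cases hij : i = j
    · simp [hij]
    let T : (Fin n → ℝ) →ₗ[ℝ] ℝ := (LinearMap.proj i : (Fin n → ℝ) →ₗ[ℝ] ℝ) - LinearMap.proj j
    have hT : LinearMap.ker T ≠ ⊤ := fun h => by
      have h1 : T (Pi.single i 1) = 0 := by
        rw [← LinearMap.mem_ker, h]
        trivial
      simp [T, hij] at h1
    refine measure_mono_null (fun t ht => ?_) (Measure.addHaar_submodule volume _ hT)
    simp only [Set.mem_compl_iff, Set.mem_ofPred_eq, not_forall, not_not] at ht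
    obtain ⟨-, ht⟩ := ht
    simpa [T, sub_eq_zero] using ht
  filter_upwards [h] with t ht i j hij
  by_contra hne
  exact ht i j hne hij

lemma existsUnique_perm_mem_chamber {n : ℕ} {t : Fin n → ℝ} (ht : Function.Injective t) :
    ∃! σ : Equiv.Perm (Fin n), t ∘ σ ∈ chamber n := by
  have hneg (σ : Equiv.Perm (Fin n)) : Monotone ((fun i => -t i) ∘ σ) ↔ Antitone (t ∘ σ) :=
    ⟨fun h i j hij => neg_le_neg_iff.1 (h hij), fun h i j hij => neg_le_neg (h hij)⟩
  refine ⟨Tuple.sort fun i => -t i, ?_, fun τ hτ => ?_⟩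
  · exact ((hneg _).1 (Tuple.monotone_sort _)).strictAnti_of_injective
      (ht.comp (Equiv.injective _))
  · have h := Tuple.unique_monotone ((hneg τ).2 (StrictAnti.antitone hτ))
      (Tuple.monotone_sort fun i => -t i)
    refine Equiv.ext fun i => ht ?_
    simpa using congrFun h i

lemma lintegral_comp_perm {n : ℕ} (σ : Equiv.Perm (Fin n)) {G : (Fin n → ℝ) → ℝ≥0∞}
    (hG : Measurable G) : ∫⁻ t, G (t ∘ σ) = ∫⁻ t, G t := by
  rw [← (volume_measurePreserving_piCongrLeft (fun _ : Fin n => ℝ) σ.symm).lintegral_comp hG]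
  refine lintegral_congr fun t => congrArg G ?_
  ext i
  simp [MeasurableEquiv.coe_piCongrLeft, Equiv.piCongrLeft_apply]

/-- The integral of a symmetric function is the sum of `n!` equal contributions, one for each
ordering of the variables. -/
lemma lintegral_eq_factorial_mul {n : ℕ} {G : (Fin n → ℝ) → ℝ≥0∞} (hG : Measurable G)
    (hsymm : ∀ t (σ : Equiv.Perm (Fin n)), G (t ∘ σ) = G t) :
    ∫⁻ t, G t = (n ! : ℝ≥0∞) * ∫⁻ t in chamber n, G t := by
  have hGi : Measurable ((chamber n).indicator G) := hG.indicator measurableSet_chamber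
  calc ∫⁻ t, G t = ∫⁻ t, ∑ σ : Equiv.Perm (Fin n), (chamber n).indicator G (t ∘ σ) := by
        -- a tuple with distinct entries has exactly one decreasing rearrangement
        refine lintegral_congr_ae ?_
        filter_upwards [ae_injective_pi n] with t ht
        obtain ⟨σ, hσ, huniq⟩ := existsUnique_perm_mem_chamber ht
        rw [Finset.sum_eq_single σ, Set.indicator_of_mem hσ, hsymm]
        · exact fun τ _ hτ => Set.indicator_of_notMem (fun h => hτ (huniq τ h)) _
        · simp
    _ = ∑ σ : Equiv.Perm (Fin n), ∫⁻ t in chamber n, G t := by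
        rw [lintegral_finsetSum]
        · refine Finset.sum_congr rfl fun σ _ => ?_
          rw [lintegral_comp_perm σ hGi, lintegral_indicator measurableSet_chamber]
        · exact fun σ _ => hGi.comp (measurable_pi_lambda _ fun i => measurable_pi_apply _)
    _ = _ := by simp [Finset.card_univ, Fintype.card_perm]

/-! ### The density of the projection DPP -/

lemma vandermondeSq_nonneg {n : ℕ} (t : Fin n → ℝ) : 0 ≤ vandermondeSq t := sq_nonneg _

lemma sq_prod_leadingCoeff_pos {d : ℕ} {p : Fin (d + 1) → ℝ[X]}
    (hp : ∀ i, (p i).degree = (i : ℕ)) : 0 < (∏ i, (p i).leadingCoeff) ^ 2 := by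
  have : ∏ i, (p i).leadingCoeff ≠ 0 := Finset.prod_ne_zero_iff.2 fun i _ h0 => by
    have h1 := hp i
    rw [leadingCoeff_eq_zero.1 h0] at h1
    simp at h1
  positivity

lemma designMatrix_det_sq {d : ℕ} {p : Fin (d + 1) → ℝ[X]}
    (hp : ∀ i, (p i).degree = (i : ℕ)) (t : Fin (d + 1) → ℝ) :
    (designMatrix p t).det ^ 2 = (∏ i, (p i).leadingCoeff) ^ 2 * vandermondeSq t := by
  have hnat (i : Fin (d + 1)) : (p i).natDegree = i := natDegree_eq_of_degree_eq_some (hp i)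
  have h := Matrix.eval_matrixOfPolynomials_eq_vandermonde_mul_matrixOfPolynomials t p
    fun i => (hnat i).le
  have h1 : (Matrix.of fun i j : Fin (d + 1) => (p j).coeff i).det = ∏ i, (p i).leadingCoeff := by
    rw [Matrix.det_of_isUpperTriangular]
    · exact Finset.prod_congr rfl fun i _ => by simp [leadingCoeff, hnat]
    · intro i j hij
      exact coeff_eq_zero_of_natDegree_lt (by rw [hnat]; exact hij)
  have h2 : designMatrix p t = (Matrix.of fun i j => (p j).eval (t i)).transpose := rfl
  rw [h2, Matrix.det_transpose, h, Matrix.det_mul, h1, vandermondeSq]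
  ring

lemma dppDensityFun_nonneg {μ : ℝ → ℝ} (hμ : IsPDF μ) {d : ℕ} (p : Fin (d + 1) → ℝ[X])
    (t : Fin (d + 1) → ℝ) : 0 ≤ dppDensityFun μ p t :=
  mul_nonneg (by positivity) (Finset.prod_nonneg fun i _ => hμ.nonneg _)

lemma measurable_dppDensityFun {μ : ℝ → ℝ} (hμ : IsPDF μ) {d : ℕ} (p : Fin (d + 1) → ℝ[X]) :
    Measurable (dppDensityFun μ p) := by
  have h : Continuous fun t : Fin (d + 1) → ℝ => (designMatrix p t).det := by
    refine Continuous.matrix_det (continuous_matrix fun i j => ?_)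
    exact (p i).continuous.comp (continuous_apply j)
  refine Measurable.mul (h.abs.pow 2).measurable ?_
  exact Finset.measurable_prod _ fun i _ => hμ.measurable.comp (measurable_pi_apply i)

/-- The product `pᵢ pⱼ μ`. -/
def weightedProd (μ : ℝ → ℝ) {d : ℕ} (p : Fin (d + 1) → ℝ[X]) (i j : Fin (d + 1)) (t : ℝ) : ℝ :=
  (p i).eval t * (p j).eval t * μ t

lemma toReal_smul_eq_weightedProd {μ : ℝ → ℝ} (hμ : IsPDF μ) {d : ℕ} (p : Fin (d + 1) → ℝ[X])
    (i j : Fin (d + 1)) (t : ℝ) :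
    (ENNReal.ofReal (μ t)).toReal • ((p i).eval t * (p j).eval t) = weightedProd μ p i j t := by
  rw [ENNReal.toReal_ofReal (hμ.nonneg t), weightedProd, smul_eq_mul, mul_comm]

lemma integral_weightedProd {μ : ℝ → ℝ} (hμ : IsPDF μ) {d : ℕ} {p : Fin (d + 1) → ℝ[X]}
    (hp : IsOrthonormalPolys μ p) (i j : Fin (d + 1)) :
    ∫ t, weightedProd μ p i j t = if i = j then 1 else 0 := by
  rw [← hp.orthonormal i j, distr, integral_withDensity_eq_integral_toReal_smul
    hμ.measurable.ennreal_ofReal (by simp)]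
  simp only [toReal_smul_eq_weightedProd hμ]

lemma integrable_weightedProd {μ : ℝ → ℝ} (hμ : IsPDF μ) {d : ℕ} {p : Fin (d + 1) → ℝ[X]}
    (hp : IsOrthonormalPolys μ p) (i j : Fin (d + 1)) : Integrable (weightedProd μ p i j) := by
  have hsq (i : Fin (d + 1)) : Integrable (weightedProd μ p i i) := by
    -- otherwise the integral would have the junk value `0` instead of `1`
    by_contra h
    have h1 := integral_weightedProd hμ hp i i
    rw [integral_undef h] at h1
    simp at h1
  refine ((hsq i).add (hsq j)).mono' ?_ (ae_of_all _ fun t => ?_)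
  · exact ((((p i).continuous.mul (p j).continuous).measurable).mul
      hμ.measurable).aestronglyMeasurable
  · have h0 := hμ.nonneg t
    simp only [weightedProd, Pi.add_apply, Real.norm_eq_abs, abs_mul, abs_of_nonneg h0, ← add_mul]
    refine mul_le_mul_of_nonneg_right ?_ h0
    nlinarith [sq_nonneg (|(p i).eval t| - |(p j).eval t|), abs_mul_abs_self ((p i).eval t),
      abs_mul_abs_self ((p j).eval t), abs_nonneg ((p i).eval t), abs_nonneg ((p j).eval t)]

lemma dppDensityFun_eq_sum (μ : ℝ → ℝ) {d : ℕ} (p : Fin (d + 1) → ℝ[X]) (t : Fin (d + 1) → ℝ) :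
    dppDensityFun μ p t = ∑ σ : Equiv.Perm (Fin (d + 1)), ∑ τ : Equiv.Perm (Fin (d + 1)),
      ((Equiv.Perm.sign σ : ℝ) * (Equiv.Perm.sign τ : ℝ)) *
        ∏ k, weightedProd μ p (σ k) (τ k) (t k) := by
  rw [dppDensityFun, sq_abs, sq, Matrix.det_apply', Finset.sum_mul_sum, Finset.sum_mul]
  refine Finset.sum_congr rfl fun σ _ => ?_
  rw [Finset.sum_mul]
  refine Finset.sum_congr rfl fun τ _ => ?_
  simp only [weightedProd, Finset.prod_mul_distrib, designMatrix, Matrix.of_apply]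
  ring

/-- Andréief's identity for orthonormal polynomials: expanding both determinants, only the pairs of
equal permutations contribute. -/
lemma lintegral_dppDensityFun {μ : ℝ → ℝ} (hμ : IsPDF μ) {d : ℕ} {p : Fin (d + 1) → ℝ[X]}
    (hp : IsOrthonormalPolys μ p) :
    ∫⁻ t, ENNReal.ofReal (dppDensityFun μ p t) = ((d + 1)! : ℝ≥0∞) := by
  have hint (σ τ : Equiv.Perm (Fin (d + 1))) : Integrable fun t : Fin (d + 1) → ℝ =>
      ((Equiv.Perm.sign σ : ℝ) * (Equiv.Perm.sign τ : ℝ)) *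
        ∏ k, weightedProd μ p (σ k) (τ k) (t k) :=
    (Integrable.fintype_prod fun k => integrable_weightedProd hμ hp (σ k) (τ k)).const_mul _
  have hI : Integrable (dppDensityFun μ p) := by
    rw [show dppDensityFun μ p = _ from funext (dppDensityFun_eq_sum μ p)]
    exact integrable_finsetSum _ fun σ _ => integrable_finsetSum _ fun τ _ => hint σ τ
  rw [← ofReal_integral_eq_lintegral_ofReal hI (ae_of_all _ (dppDensityFun_nonneg hμ p))]
  have h : ∫ t, dppDensityFun μ p t = ((d + 1)! : ℝ) := by
    simp only [dppDensityFun_eq_sum]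
    rw [integral_finsetSum _ fun σ _ => integrable_finsetSum _ fun τ _ => hint σ τ]
    have hterm (σ : Equiv.Perm (Fin (d + 1))) : ∫ t : Fin (d + 1) → ℝ,
        ∑ τ : Equiv.Perm (Fin (d + 1)), ((Equiv.Perm.sign σ : ℝ) * (Equiv.Perm.sign τ : ℝ)) *
          ∏ k, weightedProd μ p (σ k) (τ k) (t k) = 1 := by
      rw [integral_finsetSum _ fun τ _ => hint σ τ, Finset.sum_eq_single σ]
      · rw [integral_const_mul,
          integral_fintype_prod_volume_eq_prod fun k => weightedProd μ p (σ k) (σ k)]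
        simp only [integral_weightedProd hμ hp, if_true, Finset.prod_const_one, mul_one]
        rcases Int.units_eq_one_or (Equiv.Perm.sign σ) with h | h <;> simp [h]
      · intro τ _ hτ
        rw [integral_const_mul,
          integral_fintype_prod_volume_eq_prod fun k => weightedProd μ p (σ k) (τ k)]
        obtain ⟨k, hk⟩ : ∃ k, σ k ≠ τ k := by
          by_contra! h
          exact hτ (Equiv.ext h).symm
        rw [Finset.prod_eq_zero (Finset.mem_univ k)
          (by rw [integral_weightedProd hμ hp, if_neg hk]), mul_zero]
      · simp
    simp only [hterm]
    simp [Finset.card_univ, Fintype.card_perm]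
  rw [h, ENNReal.ofReal_natCast]

lemma measurable_toConfig {n : ℕ} : Measurable (toConfig (n := n)) := measurable_quotient_mk''

lemma toConfig_comp_perm {n : ℕ} (t : Fin n → ℝ) (σ : Equiv.Perm (Fin n)) :
    toConfig (t ∘ σ) = toConfig t :=
  Quotient.sound ⟨σ, rfl⟩

lemma measurable_dppDensity {μ : ℝ → ℝ} (hμ : IsPDF μ) {d : ℕ} (p : Fin (d + 1) → ℝ[X]) :
    Measurable (dppDensity μ p) :=
  measurable_from_quotient.2 (measurable_dppDensityFun hμ p)

lemma projectionDPP_apply {μ : ℝ → ℝ} (hμ : IsPDF μ) {d : ℕ} (p : Fin (d + 1) → ℝ[X])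
    {S : Set (Config (d + 1))} (hS : MeasurableSet S) :
    projectionDPP μ p S = ((d + 1)! : ℝ≥0∞)⁻¹ *
      ∫⁻ t, (toConfig ⁻¹' S).indicator (fun t => ENNReal.ofReal (dppDensityFun μ p t)) t := by
  rw [projectionDPP, withDensity_apply _ hS, configLebesgue, Measure.restrict_smul,
    lintegral_smul_measure, smul_eq_mul,
    setLIntegral_map hS (measurable_dppDensity hμ p).ennreal_ofReal measurable_toConfig,
    lintegral_indicator (measurable_toConfig hS)]
  rfl

lemma projectionDPP_apply_chamber {μ : ℝ → ℝ} (hμ : IsPDF μ) {d : ℕ} (p : Fin (d + 1) → ℝ[X])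
    {S : Set (Config (d + 1))} (hS : MeasurableSet S) :
    projectionDPP μ p S = ∫⁻ t in chamber (d + 1),
      (toConfig ⁻¹' S).indicator (fun t => ENNReal.ofReal (dppDensityFun μ p t)) t := by
  have hm := (measurable_dppDensityFun hμ p).ennreal_ofReal.indicator (measurable_toConfig hS)
  rw [projectionDPP_apply hμ p hS, lintegral_eq_factorial_mul hm, ← mul_assoc,
    ENNReal.inv_mul_cancel (by positivity) (ENNReal.natCast_ne_top _), one_mul]
  intro t σ
  classical
  simp only [Set.indicator_apply, Set.mem_preimage, toConfig_comp_perm, dppDensityFun_comp_perm]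

lemma isProbabilityMeasure_projectionDPP {μ : ℝ → ℝ} (hμ : IsPDF μ) {d : ℕ}
    {p : Fin (d + 1) → ℝ[X]} (hp : IsOrthonormalPolys μ p) :
    IsProbabilityMeasure (projectionDPP μ p) := by
  refine ⟨?_⟩
  rw [projectionDPP_apply hμ p MeasurableSet.univ]
  simp only [Set.preimage_univ, Set.indicator_univ]
  rw [lintegral_dppDensityFun hμ hp,
    ENNReal.inv_mul_cancel (by positivity) (ENNReal.natCast_ne_top _)]

/-! ### The unitary ensemble -/

lemma eigenvalueConfig_eq {n : ℕ} (A : HermMat n) :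
    eigenvalueConfig A = toConfig (sortedEigenvalues A) := by
  obtain ⟨σ, hσ⟩ := exists_perm_eigenvalues A
  rw [eigenvalueConfig, hσ, toConfig_comp_perm]

lemma measurable_eigenvalueConfig {n : ℕ} : Measurable (eigenvalueConfig (n := n)) := by
  rw [show eigenvalueConfig (n := n) = fun A => toConfig (sortedEigenvalues A) from
    funext eigenvalueConfig_eq]
  exact measurable_toConfig.comp measurable_sortedEigenvalues

lemma ensembleWeight_eq (μ : ℝ → ℝ) {n : ℕ} (A : HermMat n) :
    ensembleWeight μ A = ∏ i, μ (sortedEigenvalues A i) := by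
  obtain ⟨σ, hσ⟩ := exists_perm_eigenvalues A
  rw [ensembleWeight, hσ]
  exact Equiv.prod_comp σ fun i => μ (sortedEigenvalues A i)

lemma measurable_prod_density {μ : ℝ → ℝ} (hμ : IsPDF μ) {n : ℕ} :
    Measurable fun t : Fin n → ℝ => ∏ i, μ (t i) :=
  Finset.measurable_prod _ fun i _ => hμ.measurable.comp (measurable_pi_apply i)

lemma WeylFormula.lintegral_hermLebesgue {n : ℕ} {C : ℝ≥0∞} (h : WeylFormula n C)
    {F : (Fin n → ℝ) → ℝ≥0∞} (hF : Measurable F) :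
    ∫⁻ A, F (sortedEigenvalues A) ∂(hermLebesgue n) =
      C * ∫⁻ t in chamber n, F t * ENNReal.ofReal (vandermondeSq t) := by
  rw [hermLebesgue, lintegral_map (f := fun A => F (sortedEigenvalues A))
    (hF.comp measurable_sortedEigenvalues) continuous_hermOfCoords.measurable, h F hF]

/-- Lebesgue measure weighted by `∏ μ(λᵢ)`, the unitary ensemble before normalization. -/
def unnormalizedEnsemble (μ : ℝ → ℝ) (n : ℕ) : Measure (HermMat n) :=
  (hermLebesgue n).withDensity fun A => ENNReal.ofReal (ensembleWeight μ A)

lemma WeylFormula.map_unnormalizedEnsemble {d : ℕ} {C : ℝ≥0∞} (h : WeylFormula (d + 1) C)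
    {μ : ℝ → ℝ} (hμ : IsPDF μ) {p : Fin (d + 1) → ℝ[X]} (hp : IsOrthonormalPolys μ p) :
    (unnormalizedEnsemble μ (d + 1)).map eigenvalueConfig =
      (C * (ENNReal.ofReal ((∏ i, (p i).leadingCoeff) ^ 2))⁻¹) • projectionDPP μ p := by
  have hκ := sq_prod_leadingCoeff_pos hp.degree_eq
  set κ := (∏ i, (p i).leadingCoeff) ^ 2 with hκdef
  ext S hS
  have hF : Measurable ((toConfig ⁻¹' S).indicator fun t : Fin (d + 1) → ℝ =>
      ENNReal.ofReal (∏ i, μ (t i))) :=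
    (measurable_prod_density hμ).ennreal_ofReal.indicator (measurable_toConfig hS)
  have hlhs : (unnormalizedEnsemble μ (d + 1)).map eigenvalueConfig S =
      ∫⁻ A, (toConfig ⁻¹' S).indicator (fun t : Fin (d + 1) → ℝ => ENNReal.ofReal (∏ i, μ (t i)))
        (sortedEigenvalues A) ∂(hermLebesgue (d + 1)) := by
    rw [Measure.map_apply measurable_eigenvalueConfig hS, unnormalizedEnsemble,
      withDensity_apply _ (measurable_eigenvalueConfig hS),
      ← lintegral_indicator (measurable_eigenvalueConfig hS)]
    refine lintegral_congr fun A => ?_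
    classical
    simp only [Set.indicator_apply, Set.mem_preimage, eigenvalueConfig_eq, ensembleWeight_eq]
  rw [hlhs, h.lintegral_hermLebesgue hF, Measure.smul_apply, smul_eq_mul,
    projectionDPP_apply_chamber hμ p hS, mul_assoc]
  congr 1
  rw [← lintegral_const_mul']
  · refine lintegral_congr fun t => ?_
    by_cases ht : t ∈ toConfig ⁻¹' S
    · rw [Set.indicator_of_mem ht, Set.indicator_of_mem ht, dppDensityFun, sq_abs,
        designMatrix_det_sq hp.degree_eq, ← hκdef, mul_assoc, ENNReal.ofReal_mul hκ.le, ← mul_assoc,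
        ENNReal.inv_mul_cancel (by simpa using hκ) ENNReal.ofReal_ne_top, one_mul,
        ENNReal.ofReal_mul (vandermondeSq_nonneg t), mul_comm]
    · rw [Set.indicator_of_notMem ht, Set.indicator_of_notMem ht, zero_mul, mul_zero]
  · simpa using hκ

lemma WeylFormula.ne_zero {n : ℕ} {C : ℝ≥0∞} (h : WeylFormula n C) : C ≠ 0 := by
  rintro rfl
  have h1 := h (fun _ => 1) measurable_const
  rw [zero_mul, lintegral_one] at h1
  exact (isOpen_univ.measure_pos (volume : Measure (Coord n)) Set.univ_nonempty).ne' h1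

/-- The sorted eigenvalues of a random matrix have the density of the projection DPP up to a
constant, and since the DPP is a probability measure, this constant is the one which normalizes the
ensemble. -/
lemma isProbabilityMeasure_unitaryEnsemble_and_map_eq {d : ℕ} {μ : ℝ → ℝ} (hμ : IsPDF μ)
    {p : Fin (d + 1) → ℝ[X]} (hp : IsOrthonormalPolys μ p) :
    IsProbabilityMeasure (unitaryEnsemble μ (d + 1)) ∧
      (unitaryEnsemble μ (d + 1)).map eigenvalueConfig = projectionDPP μ p := by
  obtain ⟨C, hC, h⟩ := exists_weylFormula (d + 1)
  have hmap := h.map_unnormalizedEnsemble hμ hp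
  have hprob := isProbabilityMeasure_projectionDPP hμ hp
  set c := C * (ENNReal.ofReal ((∏ i, (p i).leadingCoeff) ^ 2))⁻¹ with hc
  have hc0 : c ≠ 0 := mul_ne_zero h.ne_zero (ENNReal.inv_ne_zero.2 ENNReal.ofReal_ne_top)
  have hc1 : c ≠ ∞ := ENNReal.mul_ne_top hC (ENNReal.inv_ne_top.2
    (ENNReal.ofReal_pos.2 (sq_prod_leadingCoeff_pos hp.degree_eq)).ne')
  have hZ : ∫⁻ A, ENNReal.ofReal (ensembleWeight μ A) ∂(hermLebesgue (d + 1)) = c := by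
    have h1 := congrArg (fun m => m Set.univ) hmap
    simp only [Measure.smul_apply, measure_univ, smul_eq_mul, mul_one] at h1
    rw [Measure.map_apply measurable_eigenvalueConfig MeasurableSet.univ, Set.preimage_univ,
      unnormalizedEnsemble, withDensity_apply _ MeasurableSet.univ, Measure.restrict_univ] at h1
    exact h1
  have hU : unitaryEnsemble μ (d + 1) = c⁻¹ • unnormalizedEnsemble μ (d + 1) := by
    rw [unitaryEnsemble, hZ, unnormalizedEnsemble]
  have hmapU : (unitaryEnsemble μ (d + 1)).map eigenvalueConfig = projectionDPP μ p := by
    rw [hU, Measure.map_smul, hmap, smul_smul, ENNReal.inv_mul_cancel hc0 hc1, one_smul]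
  refine ⟨?_, hmapU⟩
  rw [← Measure.isProbabilityMeasure_map_iff measurable_eigenvalueConfig.aemeasurable, hmapU]
  exact hprob

lemma ae_injective_eigenvalues (μ : ℝ → ℝ) (n : ℕ) :
    ∀ᵐ A ∂(unitaryEnsemble μ n), Function.Injective A.2.eigenvalues := by
  obtain ⟨C, -, h⟩ := exists_weylFormula n
  have h1 : ∀ᵐ A ∂(hermLebesgue n), Function.Injective A.2.eigenvalues := by
    have hm : MeasurableSet {A : HermMat n | Function.Injective A.2.eigenvalues} := by
      convert! measurable_sortedEigenvalues measurableSet_chamber using 1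
      ext A
      rw [Set.mem_ofPred_eq, injective_sortedEigenvalues_iff]
      exact ⟨(sortedEigenvalues_antitone A).strictAnti_of_injective,
        fun hA => StrictAnti.injective hA⟩
    exact (ae_map_iff continuous_hermOfCoords.measurable.aemeasurable hm).2 h.ae_injective
  exact Measure.ae_smul_measure (withDensity_absolutelyContinuous _ _ h1) _

end

end ProjDPP

theorem mainTheorem3 (d : ℕ) (μ : ℝ → ℝ) (hμ : ProjDPP.IsPDF μ)
    (p : Fin (d + 1) → Polynomial ℝ) (hp : ProjDPP.IsOrthonormalPolys μ p) :
    IsProbabilityMeasure (ProjDPP.unitaryEnsemble μ (d + 1)) ∧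
    ∀ {Ω : Type*} [MeasurableSpace Ω] (P : Measure Ω) [IsProbabilityMeasure P]
      (X : Ω → ProjDPP.HermMat (d + 1)),
      HasLaw X (ProjDPP.unitaryEnsemble μ (d + 1)) P →
        (∀ᵐ ω ∂P, Function.Injective (X ω).2.eigenvalues) ∧
        HasLaw (fun ω => ProjDPP.eigenvalueConfig (X ω)) (ProjDPP.projectionDPP μ p) P := by
  obtain ⟨h1, h2⟩ := ProjDPP.isProbabilityMeasure_unitaryEnsemble_and_map_eq hμ hp
  refine ⟨h1, fun P _ X hX => ⟨?_, ?_⟩⟩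
  · exact ae_of_ae_map hX.aemeasurable
      (hX.map_eq ▸ ProjDPP.ae_injective_eigenvalues μ (d + 1))
  · exact HasLaw.fun_comp ⟨ProjDPP.measurable_eigenvalueConfig.aemeasurable, h2⟩ hX
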